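/- Work in the Euclidean plane. For $0<\delta\le 1$, a $\delta$-ball is a closed ball of radius $\delta$, and a $\delta$-tube is a closed $\delta\times 1$ rectangle in arbitrary position. Two $\delta$-tubes $s,t$ are essentially distinct if the area of $s\cap t$ is at most half the area of $s$. For $0\le\beta\le 2$ and $K\ge 1$, a $(\delta,\beta,K)$-set of balls is a set $P$ of $\delta$-balls contained in $[0,1]^2$ such that for every $w\in[\delta,1]$ and every ball $B_w$ of radius $w$, $$\#\{p\in P : p\subset B_w\}\le K\,(w/\delta)^\beta .$$ For $0\le\alpha\le 2$ and $K\ge 1$, a $(\delta,\alpha,K)$-set of tubes is a set $\mathbb T$ of pairwise essentially distinct $\delta$-tubes contained in $[0,1]^2$ such that for every $w\in[\delta,1]$ and every $w\times 2$ rectangle $T_w$, $$\#\{t\in\mathbb T : t\subset T_w\}\le K\,(w/\delta)^\alpha .$$ (Such sets are finite, since $B_1$ and $T_1$ may be chosen to contain $[0,1]^2$.) Let $I(P,\mathbb T)$ be the number of pairs $(p,t)\in P\times\mathbb T$ with $p\cap t\ne\emptyset$. **Theorem.** For every $\varepsilon>0$ there is a constant $C_\varepsilon>0$, depending only on $\varepsilon$,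 such that the following holds. Let $0\le\alpha,\beta\le 2$, $K_\alpha,K_\beta\ge 1$, $0<\delta\le 1$, and define $c$ by $c^{-1}=\max(\alpha+\beta-1,2)$. Then for every $(\delta,\beta,K_\beta)$-set of balls $P$ and every $(\delta,\alpha,K_\alpha)$-set of tubes $\mathbb T$, $$I(P,\mathbb T)\le C_\varepsilon\,\delta^{-c-\varepsilon}(K_\alpha K_\beta)^c\,|P|^{1-c}\,|\mathbb T|^{1-c}.$$ -/

import Mathlib

open scoped RealInnerProductSpace

noncomputable section

namespace TubeIncidence

/-- The Euclidean plane. -/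
abbrev Plane : Type := EuclideanSpace ℝ (Fin 2)

/-- The unit square `[0, 1]²`. -/
def unitSquare : Set Plane := {x | ∀ i, x i ∈ Set.Icc (0 : ℝ) 1}

/-- `B` is a (closed) ball of radius `r`. -/
def IsBall (r : ℝ) (B : Set Plane) : Prop :=
  ∃ x : Plane, B = Metric.closedBall x r

/-- `R` is a (closed) `a × b` rectangle, in an arbitrary position: `x` is its centre, the side of
length `a` has direction `u`, the side of length `b` has the orthogonal direction `v`. -/
def IsRectangle (a b : ℝ) (R : Set Plane) : Prop :=
  ∃ x u v : Plane, ‖u‖ = 1 ∧ ‖v‖ = 1 ∧ ⟪u, v⟫ = 0 ∧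
    R = {y | |⟪y - x, u⟫| ≤ a / 2 ∧ |⟪y - x, v⟫| ≤ b / 2}

/-- A `δ`-tube is a `δ × 1` rectangle. -/
def IsTube (δ : ℝ) (t : Set Plane) : Prop := IsRectangle δ 1 t

/-- Two tubes (of the same dimensions) are essentially distinct if their intersection has at most
half the area of a tube. -/
def EssentiallyDistinct (s t : Set Plane) : Prop :=
  MeasureTheory.volume (s ∩ t) ≤ MeasureTheory.volume s / 2

open Classical in
/-- `P` is a `(δ, β, K)`-set of balls. -/
structure IsBallSet (δ β K : ℝ) (P : Finset (Set Plane)) : Prop where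
  isBall : ∀ p ∈ P, IsBall δ p
  subset_unitSquare : ∀ p ∈ P, p ⊆ unitSquare
  card_le : ∀ w ∈ Set.Icc δ 1, ∀ B : Set Plane, IsBall w B →
    ((P.filter fun p => p ⊆ B).card : ℝ) ≤ K * (w / δ) ^ β

open Classical in
/-- `T` is a `(δ, α, K)`-set of tubes. -/
structure IsTubeSet (δ α K : ℝ) (T : Finset (Set Plane)) : Prop where
  isTube : ∀ t ∈ T, IsTube δ t
  subset_unitSquare : ∀ t ∈ T, t ⊆ unitSquare
  essentiallyDistinct : ∀ s ∈ T, ∀ t ∈ T, s ≠ t → EssentiallyDistinct s t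
  card_le : ∀ w ∈ Set.Icc δ 1, ∀ R : Set Plane, IsRectangle w 2 R →
    ((T.filter fun t => t ⊆ R).card : ℝ) ≤ K * (w / δ) ^ α

open Classical in
/-- The number of pairs `(p, t) ∈ P × T` such that `p` intersects `t`. -/
def incidences (P T : Finset (Set Plane)) : ℕ :=
  ((P ×ˢ T).filter fun q => (q.1 ∩ q.2).Nonempty).card

end TubeIncidence

end

open MeasureTheory Real

open scoped RealInnerProductSpace

namespace TubeIncidence

/-! A tube lies within `δ` of a line `y = m x + b` over one of the two axes with `|m| ≤ 1`, so a
ball with centre `(x, y)` meeting it has `|y - m x - b| ≤ 3 δ`. A Fejér kernel majorises this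
condition by frequencies `n ≲ 1 / δ`, which bounds the count by `δ ∫ |S n| dn` with `S n = ∑ cos (2π
n (y - m x - b))` (`lineIncidences_le_integral`).

On a dyadic block `n ∼ N` the sum would split into a point factor and a line factor if all slopes
were equal. Slopes matter only up to `1 / N`, so each line is averaged over a window of slopes `v`
of that length (`lineSum_eq_integral`). For fixed `v` the sum is bilinear, and Cauchy–Schwarz
followed by integration in `v` and `n` leaves two `L²` norms. Gaussian domination
(`integral_le_gaussian_sum`) turns these into weighted counts of pairs of points, and of pairs `(m,
b)`, at distance about `1 / N`, which the dimension hypotheses control.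

With `q = 1 / (N δ)`, a block contributes about `√(|P| |T| Kα Kβ q ^ (α + β - 3) / δ)`. Replacing `α
+ β` by `σ = max (α + β) 3` makes this nondecreasing in `q`, so the coarsest scale `q = z` is the
worst. Frequencies below `1 / (z δ)` are bounded trivially and contribute about `|P| |T| / z`.
Equating the two fixes `z` and gives `c = 1 / (σ - 1)`; the logarithmic number of blocks costs `δ ^
(-ε)`. -/

/-! ### Gaussian integrals, trigonometric sums and averaging. -/

theorem gaussian_mul_cos_eq_re (a b φ x : ℝ) :
    exp (-π * x ^ 2 / a ^ 2) * cos (2 * π * (x * b) + φ) =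
      (Complex.exp ((-π / a ^ 2 : ℝ) * (x : ℂ) ^ 2 + (2 * π * b : ℝ) * Complex.I * x +
        φ * Complex.I)).re := by
  have : ((-π / a ^ 2 : ℝ) * (x : ℂ) ^ 2 + (2 * π * b : ℝ) * Complex.I * x + φ * Complex.I) =
      ((-π * x ^ 2 / a ^ 2 : ℝ) : ℂ) + ((2 * π * (x * b) + φ : ℝ) : ℂ) * Complex.I := by
    push_cast; ring
  rw [this, Complex.exp_add, ← Complex.ofReal_exp, Complex.re_ofReal_mul, Complex.exp_ofReal_mul_I_re]

theorem integrable_cexp_gaussian_phase {a : ℝ} (ha : 0 < a) (b φ : ℝ) :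
    Integrable fun x : ℝ => Complex.exp ((-π / a ^ 2 : ℝ) * (x : ℂ) ^ 2 +
      (2 * π * b : ℝ) * Complex.I * x + φ * Complex.I) := by
  refine integrable_cexp_quadratic' ?_ _ _
  rw [Complex.ofReal_re]
  exact div_neg_of_neg_of_pos (neg_lt_zero.2 pi_pos) (by positivity)

theorem integrable_gaussian_mul_cos {a : ℝ} (ha : 0 < a) (b φ : ℝ) :
    Integrable fun x : ℝ => exp (-π * x ^ 2 / a ^ 2) * cos (2 * π * (x * b) + φ) := by
  simp only [gaussian_mul_cos_eq_re]
  exact (integrable_cexp_gaussian_phase ha b φ).re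

/-- The Fourier transform of a Gaussian, in real form and with a phase shift. -/
theorem integral_gaussian_mul_cos {a : ℝ} (ha : 0 < a) (b φ : ℝ) :
    ∫ x : ℝ, exp (-π * x ^ 2 / a ^ 2) * cos (2 * π * (x * b) + φ) =
      a * exp (-π * a ^ 2 * b ^ 2) * cos φ := by
  simp only [gaussian_mul_cos_eq_re]
  have h := integral_re (integrable_cexp_gaussian_phase ha b φ)
  simp only [RCLike.re_eq_complex_re] at h
  rw [h, integral_cexp_quadratic]
  · have h1 : ((π : ℂ) / -((-π / a ^ 2 : ℝ) : ℂ)) ^ (1 / 2 : ℂ) = (a : ℂ) := by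
      have : ((π : ℂ) / -((-π / a ^ 2 : ℝ) : ℂ)) = ((a ^ 2 : ℝ) : ℂ) := by
        have hp : (π : ℂ) ≠ 0 := by exact_mod_cast pi_ne_zero
        have ha' : (a : ℂ) ≠ 0 := by exact_mod_cast ha.ne'
        push_cast; field_simp
      rw [this, show (1 / 2 : ℂ) = ((1 / 2 : ℝ) : ℂ) by push_cast; rfl,
        ← Complex.ofReal_cpow (by positivity), ← Real.sqrt_eq_rpow, Real.sqrt_sq ha.le]
    have h2 : (φ : ℂ) * Complex.I - ((2 * π * b : ℝ) * Complex.I) ^ 2 /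
        (4 * ((-π / a ^ 2 : ℝ) : ℂ)) =
        ((-π * a ^ 2 * b ^ 2 : ℝ) : ℂ) + (φ : ℂ) * Complex.I := by
      have hp : (π : ℂ) ≠ 0 := by exact_mod_cast pi_ne_zero
      have ha' : (a : ℂ) ≠ 0 := by exact_mod_cast ha.ne'
      push_cast
      rw [mul_pow, Complex.I_sq]
      field_simp
      ring
    rw [h1, h2, Complex.exp_add, ← Complex.ofReal_exp, ← mul_assoc, ← Complex.ofReal_mul,
      Complex.re_ofReal_mul, Complex.exp_ofReal_mul_I_re]
  · rw [Complex.ofReal_re]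
    exact div_neg_of_neg_of_pos (neg_lt_zero.2 pi_pos) (by positivity)

/-- The square of the modulus of the trigonometric sum `∑ w i * exp (I * θ i)`. -/
noncomputable def trigEnergy {ι : Type*} (s : Finset ι) (w θ : ι → ℝ) : ℝ :=
  ∑ i ∈ s, ∑ j ∈ s, w i * w j * cos (θ i - θ j)

theorem trigEnergy_eq {ι : Type*} (s : Finset ι) (w θ : ι → ℝ) :
    trigEnergy s w θ = (∑ i ∈ s, w i * cos (θ i)) ^ 2 + (∑ i ∈ s, w i * sin (θ i)) ^ 2 := by
  simp only [trigEnergy, sq, Finset.sum_mul_sum, ← Finset.sum_add_distrib]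
  refine Finset.sum_congr rfl fun i _ => Finset.sum_congr rfl fun j _ => ?_
  rw [cos_sub]; ring

theorem trigEnergy_nonneg {ι : Type*} (s : Finset ι) (w θ : ι → ℝ) : 0 ≤ trigEnergy s w θ := by
  rw [trigEnergy_eq]; positivity

/-- Cauchy–Schwarz for a bilinear sum of cosines, with a free parameter. -/
theorem abs_sum_sum_cos_le {ι κ : Type*} (s : Finset ι) (u : Finset κ) (w α : ι → ℝ)
    (h β : κ → ℝ) {l : ℝ} (hl : 0 < l) :
    |∑ t ∈ u, ∑ p ∈ s, h t * w p * cos (α p - β t)| ≤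
      (l * trigEnergy u h β + l⁻¹ * trigEnergy s w α) / 2 := by
  have key : ∑ t ∈ u, ∑ p ∈ s, h t * w p * cos (α p - β t) =
      (∑ t ∈ u, h t * cos (β t)) * (∑ p ∈ s, w p * cos (α p)) +
      (∑ t ∈ u, h t * sin (β t)) * (∑ p ∈ s, w p * sin (α p)) := by
    simp only [Finset.sum_mul_sum, ← Finset.sum_add_distrib]
    refine Finset.sum_congr rfl fun i _ => Finset.sum_congr rfl fun j _ => ?_
    rw [cos_sub]; ring
  rw [key, trigEnergy_eq, trigEnergy_eq]
  generalize (∑ t ∈ u, h t * cos (β t)) = A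
  generalize (∑ p ∈ s, w p * cos (α p)) = B
  generalize (∑ t ∈ u, h t * sin (β t)) = C
  generalize (∑ p ∈ s, w p * sin (α p)) = D
  have amgm : ∀ x y : ℝ, |x * y| ≤ (l * x ^ 2 + l⁻¹ * y ^ 2) / 2 := by
    intro x y
    have h1 : l * x ^ 2 + l⁻¹ * y ^ 2 - 2 * |x| * |y| = l * (|x| - l⁻¹ * |y|) ^ 2 := by
      rw [← sq_abs x, ← sq_abs y]; field_simp; ring
    have h2 : 0 ≤ l * (|x| - l⁻¹ * |y|) ^ 2 := by positivity
    rw [abs_mul]; linarith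
  have := abs_add_le (A * B) (C * D)
  have := amgm A B
  have := amgm C D
  linarith

/-- A nonnegative trigonometric polynomial on a bounded interval is dominated by its integral
against a Gaussian. -/
theorem integral_le_gaussian_sum {ι : Type*} (s : Finset ι) (c φ : ι → ι → ℝ) (b : ι → ℝ)
    {a R u v : ℝ} (ha : 0 < a) (huv : u ≤ v) (hu : -(R * a) ≤ u) (hv : v ≤ R * a)
    (hF : ∀ x, 0 ≤ ∑ i ∈ s, ∑ j ∈ s, c i j * cos (2 * π * (x * (b i - b j)) + φ i j)) :
    ∫ x in u..v, ∑ i ∈ s, ∑ j ∈ s, c i j * cos (2 * π * (x * (b i - b j)) + φ i j) ≤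
      exp (π * R ^ 2) *
        (a * ∑ i ∈ s, ∑ j ∈ s, c i j * exp (-π * a ^ 2 * (b i - b j) ^ 2) * cos (φ i j)) := by
  set F : ℝ → ℝ := fun x => ∑ i ∈ s, ∑ j ∈ s, c i j * cos (2 * π * (x * (b i - b j)) + φ i j)
    with hFdef
  have hcont : Continuous F := by fun_prop
  have hexpand : ∀ x, exp (-π * x ^ 2 / a ^ 2) * F x = ∑ i ∈ s, ∑ j ∈ s,
      c i j * (exp (-π * x ^ 2 / a ^ 2) * cos (2 * π * (x * (b i - b j)) + φ i j)) := by
    intro x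
    simp only [hFdef, Finset.mul_sum]
    refine Finset.sum_congr rfl fun i _ => Finset.sum_congr rfl fun j _ => ?_
    ring
  have hint : Integrable fun x => exp (-π * x ^ 2 / a ^ 2) * F x := by
    simp only [hexpand]
    exact integrable_finsetSum _ fun i _ => integrable_finsetSum _ fun j _ =>
      (integrable_gaussian_mul_cos ha _ _).const_mul _
  have hval : ∫ x, exp (-π * x ^ 2 / a ^ 2) * F x =
      a * ∑ i ∈ s, ∑ j ∈ s, c i j * exp (-π * a ^ 2 * (b i - b j) ^ 2) * cos (φ i j) := by
    simp only [hexpand]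
    rw [integral_finsetSum _ fun i _ => integrable_finsetSum _ fun j _ =>
      (integrable_gaussian_mul_cos ha _ _).const_mul _, Finset.mul_sum]
    refine Finset.sum_congr rfl fun i _ => ?_
    rw [integral_finsetSum _ fun j _ => (integrable_gaussian_mul_cos ha _ _).const_mul _,
      Finset.mul_sum]
    refine Finset.sum_congr rfl fun j _ => ?_
    rw [integral_const_mul, integral_gaussian_mul_cos ha]; ring
  rw [← hval, ← integral_const_mul, intervalIntegral.integral_of_le huv]
  have hnn : ∀ x, 0 ≤ exp (π * R ^ 2) * (exp (-π * x ^ 2 / a ^ 2) * F x) := fun x =>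
    mul_nonneg (exp_pos _).le (mul_nonneg (exp_pos _).le (hF x))
  -- Since `|x| ≤ R * a` on the interval, the Gaussian weight there is at least `exp (-π R²)`.
  calc ∫ x in Set.Ioc u v, F x
      ≤ ∫ x in Set.Ioc u v, exp (π * R ^ 2) * (exp (-π * x ^ 2 / a ^ 2) * F x) := by
        refine setIntegral_mono_on ?_ (hint.const_mul _).integrableOn measurableSet_Ioc ?_
        · exact (hcont.integrableOn_Icc).mono_set Set.Ioc_subset_Icc_self
        · intro x hx
          have hx2 : x ^ 2 ≤ (R * a) ^ 2 := by
            rw [sq_le_sq]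
            rw [abs_of_nonneg (a := R * a) (by linarith)]
            exact abs_le.2 ⟨by linarith [hx.1], by linarith [hx.2]⟩
          rw [← mul_assoc, ← exp_add]
          refine le_mul_of_one_le_left (hF x) (one_le_exp ?_)
          have : x ^ 2 / a ^ 2 ≤ R ^ 2 := by
            rw [div_le_iff₀ (by positivity)]; nlinarith
          have := mul_le_mul_of_nonneg_left this pi_pos.le
          have e : -π * x ^ 2 / a ^ 2 = -(π * (x ^ 2 / a ^ 2)) := by ring
          rw [e]; linarith
    _ ≤ _ := setIntegral_le_integral (hint.const_mul _) (Filter.Eventually.of_forall hnn)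

/-- Gaussian sums over a set whose counting function grows at most quadratically. -/
theorem sum_gaussian_le {ι : Type*} (s : Finset ι) (r : ι → ℝ) (hr : ∀ i ∈ s, 0 ≤ r i)
    {M : ℝ} (hM : 0 ≤ M)
    (hcount : ∀ j : ℕ, 1 ≤ j → ((s.filter fun i => r i ≤ j).card : ℝ) ≤ M * (j : ℝ) ^ 2) :
    ∑ i ∈ s, exp (-π * r i ^ 2) ≤ 2 * exp 4 * M := by
  classical
  -- A fourth power against a quadratic count leaves the convergent series `∑ j⁻²`. The shift by one
  -- makes the layers start at `j = 1`, where `hcount` applies.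
  have hterm : ∀ i ∈ s, exp (-π * r i ^ 2) ≤ exp 4 * (((⌊r i⌋₊ + 1 : ℕ) : ℝ) ^ 4)⁻¹ := by
    intro i hi
    have h0 := hr i hi
    have hfl : ((⌊r i⌋₊ + 1 : ℕ) : ℝ) ≤ exp (r i) := by
      push_cast
      linarith [Nat.floor_le h0, add_one_le_exp (r i)]
    have hpow : ((⌊r i⌋₊ + 1 : ℕ) : ℝ) ^ 4 ≤ exp (4 * r i) := by
      calc _ ≤ exp (r i) ^ 4 := by gcongr
        _ = exp (4 * r i) := by rw [← exp_nat_mul]; norm_num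
    have hpos : (0 : ℝ) < ((⌊r i⌋₊ + 1 : ℕ) : ℝ) ^ 4 := by positivity
    rw [← div_eq_mul_inv, le_div_iff₀ hpos]
    calc exp (-π * r i ^ 2) * ((⌊r i⌋₊ + 1 : ℕ) : ℝ) ^ 4
        ≤ exp (-π * r i ^ 2) * exp (4 * r i) := by gcongr
      _ = exp (-π * r i ^ 2 + 4 * r i) := (exp_add _ _).symm
      _ ≤ exp 4 := exp_le_exp.2 (by nlinarith [pi_gt_three, sq_nonneg (r i - 2), sq_nonneg (r i)])
  set J : ℕ := s.sup fun i => ⌊r i⌋₊ + 1 with hJ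
  have hmaps : ∀ i ∈ s, ⌊r i⌋₊ + 1 ∈ Finset.Ioo 0 (J + 1) := fun i hi =>
    Finset.mem_Ioo.2 ⟨Nat.succ_pos _,
      Nat.lt_succ_of_le (Finset.le_sup (f := fun i => ⌊r i⌋₊ + 1) hi)⟩
  calc ∑ i ∈ s, exp (-π * r i ^ 2)
      ≤ ∑ i ∈ s, exp 4 * (((⌊r i⌋₊ + 1 : ℕ) : ℝ) ^ 4)⁻¹ := Finset.sum_le_sum hterm
    _ = ∑ j ∈ Finset.Ioo 0 (J + 1), ∑ i ∈ s with ⌊r i⌋₊ + 1 = j,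
          exp 4 * (((⌊r i⌋₊ + 1 : ℕ) : ℝ) ^ 4)⁻¹ :=
        (Finset.sum_fiberwise_of_maps_to hmaps _).symm
    _ ≤ ∑ j ∈ Finset.Ioo 0 (J + 1), exp 4 * M * ((j : ℝ) ^ 2)⁻¹ := by
        refine Finset.sum_le_sum fun j hj => ?_
        have hj1 : 1 ≤ j := (Finset.mem_Ioo.1 hj).1
        have hj0 : (0 : ℝ) < j := by exact_mod_cast hj1
        have hcard : ((s.filter fun i => ⌊r i⌋₊ + 1 = j).card : ℝ) ≤ M * (j : ℝ) ^ 2 := by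
          refine le_trans ?_ (hcount j hj1)
          exact_mod_cast Finset.card_le_card (Finset.monotone_filter_right s fun i _ hi => by
            rw [← hi]; push_cast; exact (Nat.lt_floor_add_one _).le)
        calc ∑ i ∈ s with ⌊r i⌋₊ + 1 = j, exp 4 * (((⌊r i⌋₊ + 1 : ℕ) : ℝ) ^ 4)⁻¹
            = ∑ i ∈ s with ⌊r i⌋₊ + 1 = j, exp 4 * ((j : ℝ) ^ 4)⁻¹ :=
              Finset.sum_congr rfl fun i hi => by rw [(Finset.mem_filter.1 hi).2]
          _ = ((s.filter fun i => ⌊r i⌋₊ + 1 = j).card : ℝ) * (exp 4 * ((j : ℝ) ^ 4)⁻¹) := by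
              rw [Finset.sum_const, nsmul_eq_mul]
          _ ≤ M * (j : ℝ) ^ 2 * (exp 4 * ((j : ℝ) ^ 4)⁻¹) := by gcongr
          _ = exp 4 * M * ((j : ℝ) ^ 2)⁻¹ := by field_simp
    _ = exp 4 * M * ∑ j ∈ Finset.Ioo 0 (J + 1), ((j : ℝ) ^ 2)⁻¹ := by rw [Finset.mul_sum]
    _ ≤ exp 4 * M * (2 / ((0 : ℕ) + 1)) := by
        gcongr; exact sum_Ioo_inv_sq_le 0 (J + 1)
    _ = 2 * exp 4 * M := by norm_num; ring

/-- Evaluation of a `C¹` function at a point through averages over an adjacent interval. -/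
theorem eq_integral_average_sub {f f' : ℝ → ℝ} (hf : ∀ x, HasDerivAt f (f' x) x)
    (hf' : Continuous f') (x₀ : ℝ) {ρ : ℝ} (hρ : 0 < ρ) :
    f x₀ = ∫ x in x₀..x₀ + ρ, (ρ⁻¹ * f x - (1 - (x - x₀) / ρ) * f' x) := by
  have hfc : Continuous f := continuous_iff_continuousAt.2 fun x => (hf x).continuousAt
  -- This primitive vanishes at `x₀ + ρ` and equals `-f x₀` at `x₀`.
  have hd : ∀ x ∈ Set.uIcc x₀ (x₀ + ρ), HasDerivAt (fun x => -((1 - (x - x₀) / ρ) * f x))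
      (ρ⁻¹ * f x - (1 - (x - x₀) / ρ) * f' x) x := by
    intro x _
    have h1 : HasDerivAt (fun x : ℝ => 1 - (x - x₀) / ρ) (-(1 / ρ)) x :=
      (((hasDerivAt_id x).sub_const x₀).div_const ρ).const_sub 1
    refine (h1.mul (hf x)).neg.congr_deriv ?_
    ring
  rw [intervalIntegral.integral_eq_sub_of_hasDerivAt hd
    (Continuous.intervalIntegrable (by fun_prop) _ _)]
  field_simp
  ring

/-! ### `L²` estimates over slopes and one dyadic block of frequencies. -/

section Windows

variable {ι κ : Type*} (s : Finset ι) (u : Finset κ) (x y : ι → ℝ) (m b : κ → ℝ)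

/-- Gaussian-weighted number of pairs of points of the plane at distance `1 / N`. -/
noncomputable def pairEnergy {ι : Type*} (s : Finset ι) (x y : ι → ℝ) (N : ℝ) : ℝ :=
  ∑ i ∈ s, ∑ j ∈ s, exp (-π * (N * max |x i - x j| |y i - y j|) ^ 2)

theorem pairEnergy_le {ι : Type*} (s : Finset ι) (x y : ι → ℝ) {N M : ℝ} (hN : 0 < N)
    (hM : 0 ≤ M)
    (hcount : ∀ i ∈ s, ∀ k : ℕ, 1 ≤ k →
      ((s.filter fun j => max |x i - x j| |y i - y j| ≤ k * N⁻¹).card : ℝ) ≤ M * (k : ℝ) ^ 2) :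
    pairEnergy s x y N ≤ s.card * (2 * exp 4 * M) := by
  rw [pairEnergy, ← nsmul_eq_mul]
  refine Finset.sum_le_card_nsmul _ _ _ fun i hi => ?_
  refine sum_gaussian_le s (fun j => N * max |x i - x j| |y i - y j|)
    (fun j _ => mul_nonneg hN.le (le_max_of_le_left (abs_nonneg _))) hM fun k hk => ?_
  refine le_of_eq_of_le ?_ (hcount i hi k hk)
  congr 2
  refine Finset.filter_congr fun j _ => ?_
  rw [← div_eq_mul_inv, le_div_iff₀ hN, mul_comm]

/-- `L²` bound for sums over points, with the slope and the frequency localized. -/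
theorem integral_trigEnergy_points_le (w : ι → ℝ) {N n : ℝ} (hN : 0 < N) (hn : n ∈ Set.Icc N (2 * N)) :
    ∫ v in (-1 : ℝ)..2, trigEnergy s w (fun p => 2 * π * (n * (y p - v * x p))) ≤
      exp (16 * π) * ∑ i ∈ s, ∑ j ∈ s, w i * w j * exp (-π * N ^ 2 * (x i - x j) ^ 2) *
        cos (2 * π * (n * (y i - y j))) := by
  have hn0 : 0 < n := hN.trans_le hn.1
  have hform : ∀ v, trigEnergy s w (fun p => 2 * π * (n * (y p - v * x p))) =
      ∑ i ∈ s, ∑ j ∈ s, w i * w j * cos (2 * π * (v * (n * -x i - n * -x j)) +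
        2 * π * (n * (y i - y j))) := by
    intro v
    refine Finset.sum_congr rfl fun i _ => Finset.sum_congr rfl fun j _ => ?_
    congr 2; ring
  -- The Gaussian width `N / n` cancels the frequency, so the weight in `x i - x j` depends on `N`
  -- only. As `N / n ≥ 1 / 2`, four widths cover `[-1, 2]`.
  have ha : 0 < N / n := by positivity
  have hRa : 1 / 2 ≤ N / n := by
    rw [div_le_div_iff₀ two_pos hn0]; linarith [hn.2]
  have h := integral_le_gaussian_sum s (fun i j => w i * w j)
    (fun i j => 2 * π * (n * (y i - y j))) (fun i => n * -x i) (a := N / n) (R := 4)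
    (u := -1) (v := 2) ha (by norm_num) (by linarith) (by linarith)
    (fun v => by rw [← hform]; exact trigEnergy_nonneg _ _ _)
  simp only [hform]
  refine h.trans ?_
  have hsum : ∑ i ∈ s, ∑ j ∈ s, w i * w j * exp (-π * (N / n) ^ 2 * (n * -x i - n * -x j) ^ 2) *
        cos (2 * π * (n * (y i - y j))) =
      ∑ i ∈ s, ∑ j ∈ s, w i * w j * exp (-π * N ^ 2 * (x i - x j) ^ 2) *
        cos (2 * π * (n * (y i - y j))) := by
    refine Finset.sum_congr rfl fun i _ => Finset.sum_congr rfl fun j _ => ?_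
    congr 3; field_simp; ring
  have hnn := (intervalIntegral.integral_nonneg (a := (-1 : ℝ)) (b := 2) (by norm_num)
    (fun v _ => by rw [← hform]; exact trigEnergy_nonneg _ _ _)).trans h
  rw [hsum] at hnn ⊢
  rw [show π * (4 : ℝ) ^ 2 = 16 * π by ring] at hnn ⊢
  set Q := ∑ i ∈ s, ∑ j ∈ s, w i * w j * exp (-π * N ^ 2 * (x i - x j) ^ 2) *
        cos (2 * π * (n * (y i - y j)))
  have hQ : 0 ≤ Q := by
    have := nonneg_of_mul_nonneg_right hnn (exp_pos _)
    exact nonneg_of_mul_nonneg_right this ha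
  gcongr
  exact mul_le_of_le_one_left hQ ((div_le_one hn0).2 hn.1)

/-- The trigonometric polynomial in the previous bound is nonnegative. -/
theorem gaussian_trig_sum_nonneg (w : ι → ℝ) {N : ℝ} (hN : 0 < N) (n : ℝ) :
    0 ≤ ∑ i ∈ s, ∑ j ∈ s, w i * w j * exp (-π * N ^ 2 * (x i - x j) ^ 2) *
        cos (2 * π * (n * (y i - y j))) := by
  have hform : ∀ v, trigEnergy s w (fun p => 2 * π * (v * x p) + 2 * π * (n * y p)) =
      ∑ i ∈ s, ∑ j ∈ s, w i * w j * cos (2 * π * (v * (x i - x j)) +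
        2 * π * (n * (y i - y j))) := by
    intro v
    refine Finset.sum_congr rfl fun i _ => Finset.sum_congr rfl fun j _ => ?_
    congr 2; ring
  -- On a degenerate interval the left side is zero, so the Gaussian bound itself gives
  -- nonnegativity.
  have h := integral_le_gaussian_sum s (fun i j => w i * w j)
    (fun i j => 2 * π * (n * (y i - y j))) x (a := N) (R := 0)
    (u := 0) (v := 0) hN le_rfl (by simp) (by simp)
    (fun v => by rw [← hform]; exact trigEnergy_nonneg _ _ _)
  rw [intervalIntegral.integral_same] at h
  exact nonneg_of_mul_nonneg_right (nonneg_of_mul_nonneg_right h (exp_pos _)) hN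

/-- Bilinear estimate for points and lines, where each line is averaged over a window of slopes. -/
theorem exists_majorant_windowed_sum {N : ℝ} (hN : 1 ≤ N) (k : κ → ℝ → ℝ)
    (hkm : ∀ t, Measurable (k t)) (hk0 : ∀ t v, 0 ≤ k t v) (hk1 : ∀ t v, k t v ≤ 1)
    (hksupp : ∀ t v, v ∉ Set.Ioc (m t) (m t + N⁻¹) → k t v = 0)
    (w : ι → ℝ) (hw : ∀ p ∈ s, |w p| ≤ 1) (φ : ℝ) {l : ℝ} (hl : 0 < l) :
    ∃ F : ℝ → ℝ, Continuous F ∧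
      (∀ n ∈ Set.Icc N (2 * N), |∫ v in (-1 : ℝ)..2, ∑ t ∈ u, ∑ p ∈ s, k t v * w p *
        cos (2 * π * (n * (y p - v * x p)) - (2 * π * (n * b t) + φ))| ≤ F n) ∧
      ∫ n in N..2 * N, F n ≤
        (l * (exp (5 * π) * pairEnergy u m b N) +
          l⁻¹ * (exp (20 * π) * N * pairEnergy s x y N)) / 2 := by
  have hN0 : 0 < N := by linarith
  set c : κ → κ → ℝ := fun i j => ∫ v in (-1 : ℝ)..2, k i v * k j v with hc
  have hkint : ∀ i j, IntervalIntegrable (fun v => k i v * k j v) volume (-1) 2 := by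
    intro i j
    rw [intervalIntegrable_iff]
    refine Measure.integrableOn_of_bounded (M := 1) (by simp)
      ((hkm i).mul (hkm j)).aestronglyMeasurable ?_
    refine Filter.Eventually.of_forall fun v => ?_
    rw [norm_eq_abs, abs_of_nonneg (mul_nonneg (hk0 _ _) (hk0 _ _))]
    exact mul_le_one₀ (hk1 _ _) (hk0 _ _) (hk1 _ _)
  have hT : ∀ n, ∫ v in (-1 : ℝ)..2, trigEnergy u (fun t => k t v) (fun t => 2 * π * (n * b t) + φ) =
      ∑ i ∈ u, ∑ j ∈ u, c i j * cos (2 * π * (n * (b i - b j)) + 0) := by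
    intro n
    simp only [trigEnergy]
    rw [intervalIntegral.integral_finsetSum fun i _ => ?_]
    · refine Finset.sum_congr rfl fun i _ => ?_
      rw [intervalIntegral.integral_finsetSum fun j _ => (hkint i j).mul_const _]
      refine Finset.sum_congr rfl fun j _ => ?_
      rw [intervalIntegral.integral_mul_const]
      congr 2; ring
    · simpa only [Finset.sum_fn] using
        IntervalIntegrable.sum u fun j _ => (hkint i j).mul_const _
  have hTint : ∀ n, IntervalIntegrable (fun v =>
      trigEnergy u (fun t => k t v) (fun t => 2 * π * (n * b t) + φ)) volume (-1) 2 := by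
    intro n
    simp only [trigEnergy]
    simpa only [Finset.sum_fn] using IntervalIntegrable.sum u fun i _ =>
      IntervalIntegrable.sum u fun j _ => (hkint i j).mul_const _
  have hPint : ∀ n, IntervalIntegrable (fun v =>
      trigEnergy s w (fun p => 2 * π * (n * (y p - v * x p)))) volume (-1) 2 := by
    intro n
    simp only [trigEnergy]
    exact Continuous.intervalIntegrable (by fun_prop) _ _
  have hA0 : ∀ n, 0 ≤ ∑ i ∈ u, ∑ j ∈ u, c i j * cos (2 * π * (n * (b i - b j)) + 0) := by
    intro n
    rw [← hT]
    exact intervalIntegral.integral_nonneg (by norm_num) fun v _ => trigEnergy_nonneg _ _ _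
  set A : ℝ → ℝ := fun n => ∑ i ∈ u, ∑ j ∈ u, c i j * cos (2 * π * (n * (b i - b j)) + 0) with hA
  set Q : ℝ → ℝ := fun n => ∑ i ∈ s, ∑ j ∈ s, w i * w j * exp (-π * N ^ 2 * (x i - x j) ^ 2) *
        cos (2 * π * (n * (y i - y j)) + 0) with hQ
  have hQ0 : ∀ n, 0 ≤ Q n := fun n => by
    simpa only [hQ, add_zero] using gaussian_trig_sum_nonneg s x y w hN0 n
  have hAc : Continuous A := by fun_prop
  have hQc : Continuous Q := by fun_prop
  -- An explicit trigonometric polynomial in `n` as majorant makes integrability in `n` immediate.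
  refine ⟨fun n => (l * A n + l⁻¹ * (exp (16 * π) * Q n)) / 2, by fun_prop, ?_, ?_⟩
  · intro n hn
    have hP := integral_trigEnergy_points_le s x y w hN0 hn
    calc _ ≤ ∫ v in (-1 : ℝ)..2, (l * trigEnergy u (fun t => k t v)
            (fun t => 2 * π * (n * b t) + φ) + l⁻¹ *
            trigEnergy s w (fun p => 2 * π * (n * (y p - v * x p)))) / 2 := by
          rw [← norm_eq_abs]
          refine intervalIntegral.norm_integral_le_of_norm_le (by norm_num)
            (Filter.Eventually.of_forall fun v _ => ?_)
            ((((hTint n).const_mul l).add ((hPint n).const_mul l⁻¹)).div_const 2)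
          exact abs_sum_sum_cos_le s u w _ _ _ hl
      _ = (l * A n + l⁻¹ * ∫ v in (-1 : ℝ)..2,
            trigEnergy s w (fun p => 2 * π * (n * (y p - v * x p)))) / 2 := by
          rw [intervalIntegral.integral_div, intervalIntegral.integral_add
            ((hTint n).const_mul l) ((hPint n).const_mul l⁻¹),
            intervalIntegral.integral_const_mul, intervalIntegral.integral_const_mul, hT]
      _ ≤ _ := by
          simp only [hQ, add_zero]
          gcongr
  · have h4 : exp (π * (2 : ℝ) ^ 2) = exp (4 * π) := by congr 1; ring
    -- Windows have length `1 / N`, and by `hc0` two of them interact only if their slopes are `1 /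
    -- N`-close. This localizes the slopes; the integral over `n` then localizes the intercepts.
    have hcN : ∀ i j, N * c i j ≤ 1 := by
      intro i j
      rw [← mul_inv_cancel₀ hN0.ne']
      gcongr
      simp only [hc]
      rw [intervalIntegral.integral_of_le (by norm_num)]
      calc ∫ v in Set.Ioc (-1 : ℝ) 2, k i v * k j v
          ≤ ∫ v in Set.Ioc (-1 : ℝ) 2, (Set.Ioc (m i) (m i + N⁻¹)).indicator (fun _ => 1) v := by
            refine setIntegral_mono_on ((intervalIntegrable_iff_integrableOn_Ioc_of_le
              (by norm_num)).1 (hkint i j)) ?_ measurableSet_Ioc fun v _ => ?_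
            · exact (integrable_const _).indicator measurableSet_Ioc
            · by_cases hv : v ∈ Set.Ioc (m i) (m i + N⁻¹)
              · rw [Set.indicator_of_mem hv]
                exact mul_le_one₀ (hk1 _ _) (hk0 _ _) (hk1 _ _)
              · rw [Set.indicator_of_notMem hv, hksupp i v hv, zero_mul]
        _ ≤ ∫ v, (Set.Ioc (m i) (m i + N⁻¹)).indicator (fun _ => (1 : ℝ)) v := by
            refine setIntegral_le_integral ?_ (Filter.Eventually.of_forall fun v =>
              Set.indicator_nonneg (fun _ _ => zero_le_one) v)
            exact (integrable_indicator_iff measurableSet_Ioc).2 (by simp)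
        _ = N⁻¹ := by
            rw [integral_indicator measurableSet_Ioc]
            simp [hN0.le]
    have hc0 : ∀ i j, ¬ |m i - m j| ≤ N⁻¹ → c i j = 0 := by
      intro i j hij
      have : ∀ v, k i v * k j v = 0 := by
        intro v
        by_contra hne
        have h1 : v ∈ Set.Ioc (m i) (m i + N⁻¹) := by
          by_contra h; exact hne (by rw [hksupp i v h, zero_mul])
        have h2 : v ∈ Set.Ioc (m j) (m j + N⁻¹) := by
          by_contra h; exact hne (by rw [hksupp j v h, mul_zero])
        exact hij (abs_le.2 ⟨by linarith [h1.2, h2.1], by linarith [h1.1, h2.2]⟩)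
      simp [hc, this]
    have hAint : ∫ n in N..2 * N, A n ≤ exp (5 * π) * pairEnergy u m b N := by
      have h := integral_le_gaussian_sum u c (fun _ _ => 0) b (a := N) (R := 2) (u := N)
        (v := 2 * N) hN0 (by linarith) (by linarith) le_rfl hA0
      refine h.trans ?_
      rw [h4, show 5 * π = 4 * π + π by ring, exp_add, mul_assoc]
      refine mul_le_mul_of_nonneg_left ?_ (exp_pos _).le
      simp only [pairEnergy, Finset.mul_sum]
      refine Finset.sum_le_sum fun i _ => Finset.sum_le_sum fun j _ => ?_
      rw [cos_zero, mul_one]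
      by_cases hm : |m i - m j| ≤ N⁻¹
      · have hNm : (N * |m i - m j|) ^ 2 ≤ 1 := by
          rw [sq_le_one_iff₀ (by positivity)]
          calc N * |m i - m j| ≤ N * N⁻¹ := by gcongr
            _ = 1 := mul_inv_cancel₀ hN0.ne'
        rw [← mul_assoc, ← exp_add]
        refine (mul_le_of_le_one_left (exp_pos _).le (hcN i j)).trans (exp_le_exp.2 ?_)
        -- If the slope difference is the maximum, the target weight is still at least `exp (-π)`;
        -- this loss turns `exp (4π)` into `exp (5π)`.
        rcases max_choice |m i - m j| |b i - b j| with h | h <;> rw [h]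
        · have h1 := mul_le_mul_of_nonneg_left hNm pi_pos.le
          have h2 : 0 ≤ π * N ^ 2 * (b i - b j) ^ 2 := by positivity
          linarith
        · rw [mul_pow, sq_abs]
          linarith [pi_pos]
      · rw [hc0 i j hm, zero_mul, mul_zero]
        positivity
    have hQint : ∫ n in N..2 * N, Q n ≤ exp (4 * π) * N * pairEnergy s x y N := by
      have h := integral_le_gaussian_sum s
        (fun i j => w i * w j * exp (-π * N ^ 2 * (x i - x j) ^ 2)) (fun _ _ => 0) y
        (a := N) (R := 2) (u := N)
        (v := 2 * N) hN0 (by linarith) (by linarith) le_rfl hQ0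
      refine h.trans ?_
      rw [h4, mul_assoc, pairEnergy]
      gcongr with i hi j hj
      rw [cos_zero, mul_one]
      have hww : w i * w j ≤ 1 := by
        refine (le_abs_self _).trans ?_
        rw [abs_mul]
        exact mul_le_one₀ (hw i hi) (abs_nonneg _) (hw j hj)
      rw [mul_assoc, ← exp_add]
      refine (mul_le_of_le_one_left (exp_pos _).le hww).trans (exp_le_exp.2 ?_)
      have hmax : (max |x i - x j| |y i - y j|) ^ 2 ≤ (x i - x j) ^ 2 + (y i - y j) ^ 2 := by
        rcases max_choice |x i - x j| |y i - y j| with h | h <;> rw [h, sq_abs] <;> nlinarith [sq_nonneg (x i - x j), sq_nonneg (y i - y j)]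
      have := mul_le_mul_of_nonneg_left hmax (by positivity : 0 ≤ π * N ^ 2)
      rw [mul_pow]; linarith
    rw [intervalIntegral.integral_div, intervalIntegral.integral_add
      ((hAc.const_mul l).intervalIntegrable _ _)
      (Continuous.intervalIntegrable (by fun_prop) _ _),
      intervalIntegral.integral_const_mul, intervalIntegral.integral_const_mul,
      intervalIntegral.integral_const_mul]
    have e20 : exp (20 * π) * N * pairEnergy s x y N =
        exp (16 * π) * (exp (4 * π) * N * pairEnergy s x y N) := by
      rw [show 20 * π = 16 * π + 4 * π by ring, exp_add]; ring
    rw [e20]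
    gcongr

end Windows

/-! ### The exponential sum of points and lines on a dyadic block. -/

section Lines

variable {ι κ : Type*} (s : Finset ι) (u : Finset κ) (x y : ι → ℝ) (m b : κ → ℝ)

/-- The exponential sum at frequency `n` that counts incidences between the points `(x p, y p)` and
the lines `y = m t * x + b t`. -/
noncomputable def lineSum (n : ℝ) : ℝ :=
  ∑ t ∈ u, ∑ p ∈ s, cos (2 * π * (n * (y p - m t * x p - b t)))

theorem continuous_lineSum : Continuous (lineSum s u x y m b) := by
  unfold lineSum; fun_prop

theorem abs_lineSum_le (n : ℝ) : |lineSum s u x y m b n| ≤ s.card * u.card := by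
  calc |lineSum s u x y m b n| ≤ ∑ t ∈ u, ∑ p ∈ s, (1 : ℝ) := by
        refine (Finset.abs_sum_le_sum_abs _ _).trans (Finset.sum_le_sum fun t _ => ?_)
        exact (Finset.abs_sum_le_sum_abs _ _).trans
          (Finset.sum_le_sum fun p _ => abs_cos_le_one _)
    _ = s.card * u.card := by simp [mul_comm]

/-- The window of slopes `(m, m + 1 / N]`, weighted by a function `g` of the position. -/
noncomputable def slopeWindow (N : ℝ) (g : ℝ → ℝ) (m v : ℝ) : ℝ :=
  (Set.Ioc m (m + N⁻¹)).indicator (fun v => g (N * (v - m))) v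

/-- Averaging in the slope over `(m t, m t + 1 / N]` by `eq_integral_average_sub`. The derivative
term brings a factor `2π n x p`, comparable to `N` when `n ∼ N`, so both terms have the same size.
The range `[-1, 2]` holds every window because `|m t| ≤ 1` and `1 / N ≤ 1`. -/
theorem lineSum_eq_integral {N : ℝ} (hN : 1 ≤ N) (hm : ∀ t ∈ u, |m t| ≤ 1) (n : ℝ) :
    lineSum s u x y m b n =
      N * (∫ v in (-1 : ℝ)..2, ∑ t ∈ u, ∑ p ∈ s, slopeWindow N (fun _ => 1) (m t) v * 1 *
        cos (2 * π * (n * (y p - v * x p)) - (2 * π * (n * b t) + 0))) -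
      2 * π * n * ∫ v in (-1 : ℝ)..2, ∑ t ∈ u, ∑ p ∈ s,
        slopeWindow N (fun z => 1 - z) (m t) v * x p *
          cos (2 * π * (n * (y p - v * x p)) - (2 * π * (n * b t) + π / 2)) := by
  have hN0 : 0 < N := by linarith
  have hwin : ∀ (g : ℝ → ℝ), Continuous g → ∀ (w : ι → ℝ) (φ : ℝ) (t : κ),
      IntervalIntegrable (fun v => ∑ p ∈ s, slopeWindow N g (m t) v * w p *
        cos (2 * π * (n * (y p - v * x p)) - (2 * π * (n * b t) + φ))) volume (-1) 2 ∧
      (t ∈ u → ∫ v in (-1 : ℝ)..2, ∑ p ∈ s, slopeWindow N g (m t) v * w p *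
        cos (2 * π * (n * (y p - v * x p)) - (2 * π * (n * b t) + φ)) =
        ∫ v in m t..m t + N⁻¹, g (N * (v - m t)) * ∑ p ∈ s, w p *
          cos (2 * π * (n * (y p - v * x p)) - (2 * π * (n * b t) + φ))) := by
    intro g hg w φ t
    have hform : (fun v => ∑ p ∈ s, slopeWindow N g (m t) v * w p *
        cos (2 * π * (n * (y p - v * x p)) - (2 * π * (n * b t) + φ))) =
        (Set.Ioc (m t) (m t + N⁻¹)).indicator (fun v => g (N * (v - m t)) * ∑ p ∈ s, w p *
          cos (2 * π * (n * (y p - v * x p)) - (2 * π * (n * b t) + φ))) := by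
      funext v
      by_cases hv : v ∈ Set.Ioc (m t) (m t + N⁻¹)
      · simp only [slopeWindow, Set.indicator_of_mem hv, Finset.mul_sum, mul_assoc]
      · simp [slopeWindow, Set.indicator_of_notMem hv]
    have hcont : Continuous (fun v => g (N * (v - m t)) * ∑ p ∈ s, w p *
          cos (2 * π * (n * (y p - v * x p)) - (2 * π * (n * b t) + φ))) := by fun_prop
    rw [hform]
    constructor
    · rw [intervalIntegrable_iff_integrableOn_Ioc_of_le (by norm_num)]
      exact (hcont.integrableOn_Icc.mono_set Set.Ioc_subset_Icc_self).indicator measurableSet_Ioc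
    · intro ht
      have hmt := abs_le.1 (hm t ht)
      have hNinv : N⁻¹ ≤ 1 := inv_le_one_of_one_le₀ hN
      rw [intervalIntegral.integral_of_le (by norm_num),
        intervalIntegral.integral_of_le (by linarith [inv_pos.2 hN0]),
        setIntegral_indicator measurableSet_Ioc]
      congr 2
      exact Set.inter_eq_right.2 (Set.Ioc_subset_Ioc (by linarith) (by linarith))
  rw [intervalIntegral.integral_finsetSum fun t _ => (hwin _ (by fun_prop) _ _ t).1,
    intervalIntegral.integral_finsetSum fun t _ => (hwin _ (by fun_prop) _ _ t).1,
    Finset.mul_sum, Finset.mul_sum, ← Finset.sum_sub_distrib, lineSum]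
  refine Finset.sum_congr rfl fun t ht => ?_
  rw [(hwin (fun _ => 1) (by fun_prop) (fun _ => 1) _ t).2 ht,
    (hwin (fun z => 1 - z) (by fun_prop) _ _ t).2 ht,
    ← intervalIntegral.integral_const_mul, ← intervalIntegral.integral_const_mul,
    ← intervalIntegral.integral_sub (Continuous.intervalIntegrable (by fun_prop) _ _)
      (Continuous.intervalIntegrable (by fun_prop) _ _)]
  have h := eq_integral_average_sub
    (f := fun v => ∑ p ∈ s, cos (2 * π * (n * (y p - v * x p)) - 2 * π * (n * b t)))
    (f' := fun v => ∑ p ∈ s, 2 * π * n * x p *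
      sin (2 * π * (n * (y p - v * x p)) - 2 * π * (n * b t)))
    (fun v => HasDerivAt.fun_sum fun p _ => by
      have h1 : HasDerivAt (fun v : ℝ => 2 * π * (n * (y p - v * x p)) - 2 * π * (n * b t))
          (2 * π * (n * -(1 * x p))) v :=
        (((((hasDerivAt_id v).mul_const (x p)).const_sub (y p)).const_mul n).const_mul
          (2 * π)).sub_const _
      refine h1.cos.congr_deriv ?_
      ring) (by fun_prop) (m t) (inv_pos.2 hN0)
  refine Eq.trans ?_ (h.trans ?_)
  · refine Finset.sum_congr rfl fun p _ => ?_
    congr 1; ring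
  · refine intervalIntegral.integral_congr fun v _ => ?_
    simp only [inv_inv, div_inv_eq_mul, one_mul, add_zero]
    congr 1
    rw [Finset.mul_sum, Finset.mul_sum, Finset.mul_sum]
    refine Finset.sum_congr rfl fun p _ => ?_
    -- The sine from the derivative is a cosine with phase `π / 2`, so one estimate serves both
    -- terms.
    rw [← sub_sub, cos_sub_pi_div_two]
    ring

theorem integral_abs_lineSum_le_pairEnergy {N l : ℝ} (hN : 1 ≤ N) (hl : 0 < l)
    (hm : ∀ t ∈ u, |m t| ≤ 1) (hx : ∀ p ∈ s, |x p| ≤ 1) :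
    ∫ n in N..2 * N, |lineSum s u x y m b n| ≤
      (1 + 4 * π) * N * ((l * (exp (5 * π) * pairEnergy u m b N) +
          l⁻¹ * (exp (20 * π) * N * pairEnergy s x y N)) / 2) := by
  have hN0 : 0 < N := by linarith
  have hmeas : ∀ (g : ℝ → ℝ), Continuous g → ∀ t, Measurable (slopeWindow N g (m t)) := by
    intro g hg t
    exact Measurable.indicator (by fun_prop) measurableSet_Ioc
  have hmem : ∀ t v, v ∈ Set.Ioc (m t) (m t + N⁻¹) → N * (v - m t) ∈ Set.Icc (0 : ℝ) 1 := by
    intro t v hv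
    refine ⟨mul_nonneg hN0.le (by linarith [hv.1]), ?_⟩
    rw [← mul_inv_cancel₀ hN0.ne']
    gcongr; linarith [hv.2]
  have hsupp : ∀ (g : ℝ → ℝ) t v, v ∉ Set.Ioc (m t) (m t + N⁻¹) → slopeWindow N g (m t) v = 0 :=
    fun g t v hv => Set.indicator_of_notMem hv _
  have hbd : ∀ (g : ℝ → ℝ), (∀ z ∈ Set.Icc (0 : ℝ) 1, g z ∈ Set.Icc (0 : ℝ) 1) → ∀ t v,
      slopeWindow N g (m t) v ∈ Set.Icc (0 : ℝ) 1 := by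
    intro g hg t v
    by_cases hv : v ∈ Set.Ioc (m t) (m t + N⁻¹)
    · rw [slopeWindow, Set.indicator_of_mem hv]; exact hg _ (hmem t v hv)
    · rw [hsupp g t v hv]; simp
  have hg0 : ∀ z ∈ Set.Icc (0 : ℝ) 1, (fun _ : ℝ => (1 : ℝ)) z ∈ Set.Icc (0 : ℝ) 1 := by simp
  have hg1 : ∀ z ∈ Set.Icc (0 : ℝ) 1, (fun z : ℝ => 1 - z) z ∈ Set.Icc (0 : ℝ) 1 :=
    fun z hz => ⟨by linarith [hz.2], by linarith [hz.1]⟩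
  obtain ⟨F, hFc, hF, hFint⟩ := exists_majorant_windowed_sum s u x y m b hN
    (fun t => slopeWindow N (fun _ => 1) (m t)) (hmeas _ (by fun_prop))
    (fun t v => (hbd _ hg0 t v).1) (fun t v => (hbd _ hg0 t v).2) (hsupp _)
    (fun _ => 1) (by simp) 0 hl
  obtain ⟨G, hGc, hG, hGint⟩ := exists_majorant_windowed_sum s u x y m b hN
    (fun t => slopeWindow N (fun z => 1 - z) (m t)) (hmeas _ (by fun_prop))
    (fun t v => (hbd _ hg1 t v).1) (fun t v => (hbd _ hg1 t v).2) (hsupp _)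
    x hx (π / 2) hl
  set B := (l * (exp (5 * π) * pairEnergy u m b N) +
          l⁻¹ * (exp (20 * π) * N * pairEnergy s x y N)) / 2
  calc ∫ n in N..2 * N, |lineSum s u x y m b n|
      ≤ ∫ n in N..2 * N, (N * F n + 4 * π * N * G n) := by
        refine intervalIntegral.integral_mono_on (by linarith)
          ((continuous_lineSum s u x y m b).abs.intervalIntegrable _ _)
          (Continuous.intervalIntegrable (by fun_prop) _ _) fun n hn => ?_
        have hn0 : 0 ≤ n := by linarith [hn.1]
        rw [lineSum_eq_integral s u x y m b hN hm n]
        refine (abs_sub _ _).trans ?_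
        rw [abs_mul, abs_mul, abs_of_pos hN0, abs_of_nonneg (by positivity : 0 ≤ 2 * π * n)]
        have h1 := hF n hn
        have h2 := hG n hn
        have h3 : 2 * π * n ≤ 4 * π * N := by nlinarith [pi_pos, hn.2]
        gcongr
    _ = N * (∫ n in N..2 * N, F n) + 4 * π * N * ∫ n in N..2 * N, G n := by
        rw [intervalIntegral.integral_add (Continuous.intervalIntegrable (by fun_prop) _ _)
          (Continuous.intervalIntegrable (by fun_prop) _ _),
          intervalIntegral.integral_const_mul, intervalIntegral.integral_const_mul]
    _ ≤ N * B + 4 * π * N * B := by gcongr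
    _ = _ := by ring

/-- The estimate for the frequencies in a dyadic interval. -/
theorem integral_abs_lineSum_dyadic_le {N M₁ M₂ : ℝ} (hN : 1 ≤ N) (hM₁ : 0 < M₁) (hM₂ : 0 < M₂)
    (hm : ∀ t ∈ u, |m t| ≤ 1) (hx : ∀ p ∈ s, |x p| ≤ 1)
    (hcs : ∀ i ∈ s, ∀ k : ℕ, 1 ≤ k →
      ((s.filter fun j => max |x i - x j| |y i - y j| ≤ k * N⁻¹).card : ℝ) ≤ M₁ * (k : ℝ) ^ 2)
    (hcu : ∀ i ∈ u, ∀ k : ℕ, 1 ≤ k →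
      ((u.filter fun j => max |m i - m j| |b i - b j| ≤ k * N⁻¹).card : ℝ) ≤ M₂ * (k : ℝ) ^ 2) :
    ∫ n in N..2 * N, |lineSum s u x y m b n| ≤
      2 * (1 + 4 * π) * exp (20 * π + 4) * N * √(N * (s.card * M₁) * (u.card * M₂)) := by
  have hN0 : 0 < N := by linarith
  rcases s.eq_empty_or_nonempty with rfl | hs
  · simp [lineSum]
  rcases u.eq_empty_or_nonempty with rfl | hu
  · simp [lineSum]
  have hs0 : (0 : ℝ) < s.card := by exact_mod_cast hs.card_pos
  have hu0 : (0 : ℝ) < u.card := by exact_mod_cast hu.card_pos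
  set X := N * (s.card * M₁) with hX
  set Y := u.card * M₂ with hY
  have hX0 : 0 < X := by positivity
  have hY0 : 0 < Y := by positivity
  -- The Cauchy–Schwarz parameter that balances the point and line energies.
  set l := √(X / Y) with hl
  have hl0 : 0 < l := sqrt_pos.2 (by positivity)
  have h1 : l * Y = √(X * Y) := by
    rw [hl, sqrt_div' _ hY0.le, sqrt_mul hX0.le, div_mul_eq_mul_div, div_eq_iff (by positivity), mul_assoc,
      mul_self_sqrt hY0.le]
  have h2 : l⁻¹ * X = √(X * Y) := by
    rw [inv_mul_eq_div, div_eq_iff hl0.ne', ← h1]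
    have : l * l = X / Y := mul_self_sqrt (by positivity)
    rw [mul_right_comm, this]; field_simp
  refine (integral_abs_lineSum_le_pairEnergy s u x y m b hN hl0 hm hx).trans ?_
  have e1 := pairEnergy_le s x y hN0 hM₁.le hcs
  have e2 := pairEnergy_le u m b hN0 hM₂.le hcu
  have e3 : exp (5 * π) ≤ exp (20 * π) := exp_le_exp.2 (by linarith [pi_pos])
  calc _ ≤ (1 + 4 * π) * N * ((l * (exp (20 * π) * (u.card * (2 * exp 4 * M₂))) +
          l⁻¹ * (exp (20 * π) * N * (s.card * (2 * exp 4 * M₁)))) / 2) := by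
        have : 0 ≤ pairEnergy u m b N :=
          Finset.sum_nonneg fun i _ => Finset.sum_nonneg fun j _ => (exp_pos _).le
        gcongr
    _ = (1 + 4 * π) * N * (exp (20 * π) * exp 4) * (l * Y + l⁻¹ * X) := by
        rw [hX, hY]; ring
    _ = _ := by rw [h1, h2, exp_add]; ring

end Lines

/-! ### The Fejér kernel and dyadic summation. -/

theorem fejer_integral_nonneg (L z : ℝ) : 0 ≤ ∫ n in (0 : ℝ)..L, (L - n) * cos (2 * π * (n * z)) := by
  rcases eq_or_ne z 0 with rfl | hz
  · have hd : ∀ n ∈ Set.uIcc 0 L, HasDerivAt (fun n : ℝ => L * n - n ^ 2 / 2)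
        ((L - n) * cos (2 * π * (n * 0))) n := by
      intro n _
      refine (((hasDerivAt_id n).const_mul L).sub ((hasDerivAt_pow 2 n).div_const 2)).congr_deriv ?_
      simp
    rw [intervalIntegral.integral_eq_sub_of_hasDerivAt hd
      (Continuous.intervalIntegrable (by fun_prop) _ _)]
    nlinarith [sq_nonneg L]
  · set k := 2 * π * z with hk
    have hk0 : k ≠ 0 := by simp [hk, hz, pi_ne_zero]
    have hd : ∀ n ∈ Set.uIcc 0 L, HasDerivAt
        (fun n : ℝ => (L - n) * (sin (k * n) / k) - cos (k * n) / k ^ 2)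
        ((L - n) * cos (2 * π * (n * z))) n := by
      intro n _
      have h0 : HasDerivAt (fun n : ℝ => k * n) (k * 1) n := (hasDerivAt_id n).const_mul k
      have h1 : HasDerivAt (fun n : ℝ => L - n) (-1) n := (hasDerivAt_id n).const_sub L
      refine ((h1.mul (h0.sin.div_const k)).sub (h0.cos.div_const (k ^ 2))).congr_deriv ?_
      rw [show 2 * π * (n * z) = k * n by rw [hk]; ring]
      field_simp
      ring
    rw [intervalIntegral.integral_eq_sub_of_hasDerivAt hd
      (Continuous.intervalIntegrable (by fun_prop) _ _)]
    simp only [sub_self, zero_mul, mul_zero, sin_zero, zero_div, cos_zero, zero_sub]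
    have : cos (k * L) / k ^ 2 ≤ 1 / k ^ 2 := by gcongr; exact cos_le_one _
    linarith

/-- The phase stays below `π / 4 < π / 3`, so the cosine is at least `1 / 2` throughout. -/
theorem le_fejer_integral {L z : ℝ} (hL : 0 < L) (hz : |z| * L ≤ 1 / 8) :
    L ^ 2 / 4 ≤ ∫ n in (0 : ℝ)..L, (L - n) * cos (2 * π * (n * z)) := by
  have hv : ∫ n in (0 : ℝ)..L, (L - n) * (1 / 2) = L ^ 2 / 4 := by
    rw [intervalIntegral.integral_mul_const, intervalIntegral.integral_sub (by simp)
      (Continuous.intervalIntegrable (by fun_prop) _ _)]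
    simp; ring
  rw [← hv]
  refine intervalIntegral.integral_mono_on hL.le (Continuous.intervalIntegrable (by fun_prop) _ _)
    (Continuous.intervalIntegrable (by fun_prop) _ _) fun n hn => ?_
  refine mul_le_mul_of_nonneg_left ?_ (by linarith [hn.2])
  rw [← cos_pi_div_three, ← cos_abs (2 * π * (n * z))]
  refine cos_le_cos_of_nonneg_of_le_pi (abs_nonneg _) (by linarith [pi_pos]) ?_
  rw [abs_mul, abs_of_pos (by positivity : 0 < 2 * π), abs_mul, abs_of_nonneg hn.1]
  have : n * |z| ≤ 1 / 8 := by
    refine le_trans ?_ hz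
    rw [mul_comm]; exact mul_le_mul_of_nonneg_left hn.2 (abs_nonneg _)
  nlinarith [pi_pos]

/-- A dyadic decomposition of an integral. -/
theorem integral_le_of_dyadic {f : ℝ → ℝ} (hf : Continuous f) {N₀ Z D : ℝ} (hN₀ : 0 ≤ N₀)
    (hZ : ∀ n, f n ≤ Z) (J : ℕ)
    (hD : ∀ j < J, ∫ n in (2 ^ j * N₀)..(2 * (2 ^ j * N₀)), f n ≤ D) :
    ∫ n in (0 : ℝ)..(2 ^ J * N₀), f n ≤ N₀ * Z + J * D := by
  induction J with
  | zero =>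
    simp only [pow_zero, one_mul, Nat.cast_zero, zero_mul, add_zero]
    calc ∫ n in (0 : ℝ)..N₀, f n ≤ ∫ n in (0 : ℝ)..N₀, Z :=
          intervalIntegral.integral_mono_on hN₀ (hf.intervalIntegrable _ _) (by simp)
            fun n _ => hZ n
      _ = N₀ * Z := by simp
  | succ J ih =>
    have h1 := ih fun j hj => hD j (hj.trans (Nat.lt_succ_self J))
    have h2 := hD J (Nat.lt_succ_self J)
    rw [← intervalIntegral.integral_add_adjacent_intervals
      (hf.intervalIntegrable 0 (2 ^ J * N₀)) (hf.intervalIntegrable _ _),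
      show (2 : ℝ) ^ (J + 1) * N₀ = 2 * (2 ^ J * N₀) by ring]
    push_cast
    linarith

/-! ### Incidences of points with lines, summed over all scales. -/

section Lines

variable {ι κ : Type*} (s : Finset ι) (u : Finset κ) (x y : ι → ℝ) (m b : κ → ℝ)

/-- The number of incidences of points with lines, up to an error `3 * δ`. -/
noncomputable def lineIncidences (δ : ℝ) : ℕ :=
  ∑ t ∈ u, (s.filter fun p => |y p - m t * x p - b t| ≤ 3 * δ).card

/-- Every pair has a nonnegative Fejér integral, and every incident pair has one of at least `L² /
4`. -/
theorem lineIncidences_le_integral {δ L : ℝ} (hL : 0 < L) (hδ : 3 * δ * L ≤ 1 / 8) :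
    (lineIncidences s u x y m b δ : ℝ) ≤
      4 / L * ∫ n in (0 : ℝ)..L, |lineSum s u x y m b n| := by
  have h1 : (lineIncidences s u x y m b δ : ℝ) * (L ^ 2 / 4) ≤
      ∫ n in (0 : ℝ)..L, (L - n) * lineSum s u x y m b n := by
    have e : ∫ n in (0 : ℝ)..L, (L - n) * lineSum s u x y m b n =
        ∑ t ∈ u, ∑ p ∈ s,
          ∫ n in (0 : ℝ)..L, (L - n) * cos (2 * π * (n * (y p - m t * x p - b t))) := by
      simp only [lineSum, Finset.mul_sum]
      rw [intervalIntegral.integral_finsetSum fun t _ =>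
        Continuous.intervalIntegrable (by fun_prop) _ _]
      refine Finset.sum_congr rfl fun t _ => ?_
      rw [intervalIntegral.integral_finsetSum fun t _ =>
        Continuous.intervalIntegrable (by fun_prop) _ _]
    rw [e, lineIncidences, Nat.cast_sum, Finset.sum_mul]
    refine Finset.sum_le_sum fun t _ => ?_
    calc _ ≤ ∑ p ∈ s with |y p - m t * x p - b t| ≤ 3 * δ,
          ∫ n in (0 : ℝ)..L, (L - n) * cos (2 * π * (n * (y p - m t * x p - b t))) := by
          rw [← nsmul_eq_mul]
          refine Finset.card_nsmul_le_sum _ _ _ fun p hp => le_fejer_integral hL ?_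
          exact (mul_le_mul_of_nonneg_right (Finset.mem_filter.1 hp).2 hL.le).trans hδ
      _ ≤ _ := Finset.sum_le_sum_of_subset_of_nonneg (Finset.filter_subset _ _)
          fun p _ _ => fejer_integral_nonneg _ _
  have h2 : ∫ n in (0 : ℝ)..L, (L - n) * lineSum s u x y m b n ≤
      ∫ n in (0 : ℝ)..L, L * |lineSum s u x y m b n| := by
    have hc := continuous_lineSum s u x y m b
    refine intervalIntegral.integral_mono_on hL.le
      (Continuous.intervalIntegrable (by fun_prop) _ _)
      (Continuous.intervalIntegrable (by fun_prop) _ _) fun n hn => ?_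
    calc (L - n) * lineSum s u x y m b n ≤ (L - n) * |lineSum s u x y m b n| := by
          gcongr
          · linarith [hn.2]
          · exact le_abs_self _
      _ ≤ _ := by gcongr; linarith [hn.1]
  rw [intervalIntegral.integral_const_mul] at h2
  have h3 := h1.trans h2
  rw [div_mul_eq_mul_div, le_div_iff₀ hL]
  nlinarith

/-- The constant in the estimate of a dyadic block of frequencies. -/
noncomputable def blockConst : ℝ := 2 * (1 + 4 * π) * exp (20 * π + 4)

theorem blockConst_pos : 0 < blockConst := by
  unfold blockConst; have := pi_pos; positivity

/-- Incidence bound with a free parameter `z`, the ratio of the coarsest scale to `δ`. -/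
theorem lineIncidences_le_of_scale {δ α β A₁ A₂ σ ε z : ℝ} (hδ : 0 < δ) (hδ1 : δ ≤ 1)
    (hα : α ≤ 2) (hβ : β ≤ 2) (hA₁ : 0 < A₁) (hA₂ : 0 < A₂)
    (hσ : 3 ≤ σ) (hαβ : α + β ≤ σ) (hε : 0 < ε) (hz : 0 < z) (hzδ : z * δ ≤ 1)
    (hm : ∀ t ∈ u, |m t| ≤ 1) (hx : ∀ p ∈ s, |x p| ≤ 1)
    (hcs : ∀ r, δ ≤ r → ∀ i ∈ s,
      ((s.filter fun j => max |x i - x j| |y i - y j| ≤ r).card : ℝ) ≤ A₁ * (r / δ) ^ β)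
    (hcu : ∀ r, δ ≤ r → ∀ i ∈ u,
      ((u.filter fun j => max |m i - m j| |b i - b j| ≤ r).card : ℝ) ≤ A₂ * (r / δ) ^ α) :
    (lineIncidences s u x y m b δ : ℝ) ≤ 96 * (s.card * u.card / z) +
      96 * blockConst * ((1 + 2 / ε) * δ ^ (-ε)) *
        √(s.card * u.card * (A₁ * A₂) / δ * z ^ (σ - 3)) := by
  set L : ℝ := 1 / (24 * δ) with hL
  set N₀ : ℝ := 1 / (z * δ) with hN₀
  have hL0 : 0 < L := by positivity
  have hN₀0 : 0 < N₀ := by positivity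
  have hN₀1 : 1 ≤ N₀ := by rw [hN₀, le_div_iff₀ (by positivity), one_mul]; exact hzδ
  set E := √(s.card * u.card * (A₁ * A₂) / δ * z ^ (σ - 3)) with hE
  -- If `L ≤ N₀` then `J = 0`, and the trivial bound on `[0, N₀]` covers all frequencies. Otherwise
  -- every block starts at some `N ≤ L`, so its scale `1 / N` is at least `δ` and the counting
  -- hypotheses apply.
  set J : ℕ := ⌈Real.logb 2 (L / N₀)⌉₊ with hJ
  have hLJ : L ≤ 2 ^ J * N₀ := by
    rw [← div_le_iff₀ hN₀0, ← rpow_natCast, ← Real.logb_le_iff_le_rpow one_lt_two (by positivity)]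
    exact Nat.le_ceil _
  have hJL : ∀ j < J, 2 ^ j * N₀ ≤ L := by
    intro j hj
    rw [← le_div_iff₀ hN₀0, ← rpow_natCast, ← Real.le_logb_iff_rpow_le one_lt_two (by positivity)]
    exact (Nat.lt_ceil.1 hj).le
  have hJle : (J : ℝ) ≤ (1 + 2 / ε) * δ ^ (-ε) := by
    have hδε : 1 ≤ δ ^ (-ε) := one_le_rpow_of_pos_of_le_one_of_nonpos hδ hδ1 (by linarith)
    rcases le_total (Real.logb 2 (L / N₀)) 0 with h0 | h0
    · rw [hJ, Nat.ceil_eq_zero.2 h0, Nat.cast_zero]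
      positivity
    · have h1 : (J : ℝ) < Real.logb 2 (L / N₀) + 1 := Nat.ceil_lt_add_one h0
      have h2 : L / N₀ ≤ δ⁻¹ := by
        have e : L / N₀ = z / 24 := by rw [hL, hN₀]; field_simp
        have : z ≤ δ⁻¹ := by rwa [← one_div, le_div_iff₀ hδ]
        rw [e]; linarith
      have h3 : Real.log (L / N₀) ≤ δ ^ (-ε) / ε := by
        refine (Real.log_le_rpow_div (by positivity) hε).trans ?_
        rw [rpow_neg hδ.le, ← inv_rpow hδ.le]
        gcongr
      have h4 : Real.logb 2 (L / N₀) ≤ 2 * (δ ^ (-ε) / ε) := by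
        rw [Real.logb, div_le_iff₀ (by positivity)]
        have : (0.5 : ℝ) ≤ Real.log 2 := by linarith [Real.log_two_gt_d9]
        have h5 : 0 ≤ δ ^ (-ε) / ε := by positivity
        nlinarith
      calc (J : ℝ) ≤ 2 * (δ ^ (-ε) / ε) + δ ^ (-ε) := by linarith
        _ = (1 + 2 / ε) * δ ^ (-ε) := by ring
  have hblock : ∀ j < J, ∫ n in (2 ^ j * N₀)..(2 * (2 ^ j * N₀)), |lineSum s u x y m b n| ≤
      blockConst * (E / δ) := by
    intro j hj
    have hNL := hJL j hj
    have hNN₀ : N₀ ≤ 2 ^ j * N₀ := le_mul_of_one_le_left hN₀0.le (one_le_pow₀ one_le_two)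
    generalize 2 ^ j * N₀ = N at hNL hNN₀ ⊢
    have hN1 : 1 ≤ N := hN₀1.trans hNN₀
    have hN0 : 0 < N := by linarith
    set q : ℝ := N⁻¹ / δ with hq
    have hq0 : 0 < q := by positivity
    have hqz : q ≤ z := by
      rw [hN₀, div_le_iff₀ (by positivity)] at hNN₀
      rw [hq, ← one_div, div_div, div_le_iff₀ (by positivity)]
      linarith
    have hq1 : 1 ≤ q := by
      rw [hL, le_div_iff₀ (by positivity)] at hNL
      rw [hq, ← one_div, div_div, le_div_iff₀ (by positivity)]
      nlinarith [mul_pos hN0 hδ]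
    have hcount : ∀ {K γ : ℝ} (k : ℕ), 0 < K → γ ≤ 2 → 1 ≤ k →
        K * (k * N⁻¹ / δ) ^ γ ≤ K * q ^ γ * (k : ℝ) ^ 2 := by
      intro K γ k hK hγ hk
      have hk1 : (1 : ℝ) ≤ k := by exact_mod_cast hk
      rw [mul_div_assoc, mul_rpow (by positivity) hq0.le, mul_assoc, mul_comm (q ^ γ)]
      gcongr
      rw [← rpow_natCast (k : ℝ) 2]
      exact rpow_le_rpow_of_exponent_le hk1 (by exact_mod_cast hγ)
    have hδk : ∀ k : ℕ, 1 ≤ k → δ ≤ k * N⁻¹ := by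
      intro k hk
      have hk1 : (1 : ℝ) ≤ k := by exact_mod_cast hk
      have : δ ≤ N⁻¹ := by rwa [hq, le_div_iff₀ hδ, one_mul] at hq1
      nlinarith [inv_pos.2 hN0]
    have h := integral_abs_lineSum_dyadic_le s u x y m b hN1
      (M₁ := A₁ * q ^ β) (M₂ := A₂ * q ^ α) (by positivity) (by positivity) hm hx
      (fun i hi k hk => (hcs _ (hδk k hk) i hi).trans (hcount k hA₁ hβ hk))
      (fun i hi k hk => (hcu _ (hδk k hk) i hi).trans (hcount k hA₂ hα hk))
    refine h.trans ?_
    rw [mul_assoc _ N, ← blockConst]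
    refine mul_le_mul_of_nonneg_left ?_ blockConst_pos.le
    rw [le_div_iff₀ hδ, hE]
    refine le_sqrt_of_sq_le ?_
    rw [mul_pow, mul_pow, sq_sqrt (by positivity)]
    -- Since `q ≥ 1` the exponent may be raised to `σ`. The factor `q ^ 3` cancels against `N` and
    -- `δ`, and `σ ≥ 3` lets the rest grow up to `z`.
    have hqq : q ^ α * q ^ β ≤ q ^ 3 * q ^ (σ - 3) := by
      rw [← rpow_add hq0, ← rpow_natCast q 3, ← rpow_add hq0]
      exact rpow_le_rpow_of_exponent_le hq1 (by push_cast; linarith)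
    have hqz' : q ^ (σ - 3) ≤ z ^ (σ - 3) := rpow_le_rpow hq0.le hqz (by linarith)
    have hNq : N ^ 3 * q ^ 3 * δ ^ 3 = 1 := by rw [hq]; field_simp
    calc N ^ 2 * (N * (s.card * (A₁ * q ^ β)) * (u.card * (A₂ * q ^ α))) * δ ^ 2
        = s.card * u.card * (A₁ * A₂) * (N ^ 3 * δ ^ 2) * (q ^ α * q ^ β) := by ring
      _ ≤ s.card * u.card * (A₁ * A₂) * (N ^ 3 * δ ^ 2) * (q ^ 3 * z ^ (σ - 3)) := by
          refine mul_le_mul_of_nonneg_left (hqq.trans ?_) (by positivity)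
          gcongr
      _ = s.card * u.card * (A₁ * A₂) / δ * z ^ (σ - 3) * (N ^ 3 * q ^ 3 * δ ^ 3) := by
          field_simp
      _ = _ := by rw [hNq, mul_one]
  have hc := (continuous_lineSum s u x y m b).abs
  have hsum := integral_le_of_dyadic hc hN₀0.le (abs_lineSum_le s u x y m b) J hblock
  have hmono : ∫ n in (0 : ℝ)..L, |lineSum s u x y m b n| ≤
      ∫ n in (0 : ℝ)..(2 ^ J * N₀), |lineSum s u x y m b n| :=
    intervalIntegral.integral_mono_interval le_rfl hL0.le hLJ
      (Filter.Eventually.of_forall fun _ => abs_nonneg _) (hc.intervalIntegrable _ _)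
  have h4 : 4 / L = 96 * δ := by rw [hL]; field_simp; norm_num
  have hE0 : 0 ≤ E := sqrt_nonneg _
  have hB := blockConst_pos
  calc (lineIncidences s u x y m b δ : ℝ)
      ≤ 4 / L * ∫ n in (0 : ℝ)..L, |lineSum s u x y m b n| :=
        lineIncidences_le_integral s u x y m b hL0 (by rw [hL]; field_simp; norm_num)
    _ ≤ 96 * δ * (N₀ * (s.card * u.card) + J * (blockConst * (E / δ))) := by
        rw [h4]; gcongr; exact hmono.trans hsum
    _ = 96 * (s.card * u.card / z) + 96 * blockConst * J * E := by
        rw [hN₀]; field_simp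
    _ ≤ _ := by gcongr

/-- Incidence bound for points and lines with Frostman-type counting conditions. -/
theorem lineIncidences_le {δ α β A₁ A₂ σ ε : ℝ} (hδ : 0 < δ) (hδ1 : δ ≤ 1)
    (hα : α ≤ 2) (hβ : β ≤ 2) (hA₁ : 0 < A₁) (hA₂ : 0 < A₂)
    (hσ : 3 ≤ σ) (hαβ : α + β ≤ σ) (hε : 0 < ε)
    (hm : ∀ t ∈ u, |m t| ≤ 1) (hx : ∀ p ∈ s, |x p| ≤ 1)
    (hcs : ∀ r, δ ≤ r → ∀ i ∈ s,
      ((s.filter fun j => max |x i - x j| |y i - y j| ≤ r).card : ℝ) ≤ A₁ * (r / δ) ^ β)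
    (hcu : ∀ r, δ ≤ r → ∀ i ∈ u,
      ((u.filter fun j => max |m i - m j| |b i - b j| ≤ r).card : ℝ) ≤ A₂ * (r / δ) ^ α)
    (hs : (s.card : ℝ) ≤ A₁ * (1 / δ) ^ β) (hu : (u.card : ℝ) ≤ A₂ * (1 / δ) ^ α) :
    (lineIncidences s u x y m b δ : ℝ) ≤ 96 * (1 + blockConst * (1 + 2 / ε)) *
      δ ^ (-(σ - 1)⁻¹ - ε) * (A₁ * A₂) ^ (σ - 1)⁻¹ *
        (s.card : ℝ) ^ (1 - (σ - 1)⁻¹) * (u.card : ℝ) ^ (1 - (σ - 1)⁻¹) := by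
  have hB := blockConst_pos
  rcases s.eq_empty_or_nonempty with rfl | hs'
  · simp only [lineIncidences, Finset.filter_empty, Finset.card_empty, Finset.sum_const_zero,
      Nat.cast_zero]
    positivity
  rcases u.eq_empty_or_nonempty with rfl | hu'
  · simp only [lineIncidences, Finset.sum_empty, Nat.cast_zero]
    positivity
  have hs0 : (0 : ℝ) < s.card := by exact_mod_cast hs'.card_pos
  have hu0 : (0 : ℝ) < u.card := by exact_mod_cast hu'.card_pos
  set c := (σ - 1)⁻¹ with hc
  have hσ1 : 0 < σ - 1 := by linarith
  set Z : ℝ := s.card * u.card with hZ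
  set A := A₁ * A₂ with hA
  have hZ0 : 0 < Z := by positivity
  have hA0 : 0 < A := by positivity
  set X := Z * δ / A with hX
  have hX0 : 0 < X := by positivity
  -- The solution of `z ^ (σ - 1) = X`, for which the high-frequency root equals the trivial bound
  -- `Z / z`.
  set z := X ^ c with hz
  have hz0 : 0 < z := by positivity
  have hzσ : z ^ (σ - 1) = X := by
    rw [hz, ← rpow_mul hX0.le, hc, inv_mul_cancel₀ hσ1.ne', rpow_one]
  -- The cut-off scale does not exceed the unit square, by the total cardinality bounds.
  have hzδ : z * δ ≤ 1 := by
    have hδi : 1 ≤ 1 / δ := by rwa [le_div_iff₀ hδ, one_mul]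
    have h1 : Z ≤ A * (1 / δ) ^ σ := by
      calc Z ≤ A₁ * (1 / δ) ^ β * (A₂ * (1 / δ) ^ α) := by rw [hZ]; gcongr
        _ = A * (1 / δ) ^ (α + β) := by rw [rpow_add (by positivity)]; ring
        _ ≤ A * (1 / δ) ^ σ := by
            gcongr
    have h2 : X ≤ (1 / δ) ^ (σ - 1) := by
      rw [hX, rpow_sub (by positivity), rpow_one, div_le_iff₀ hA0]
      calc Z * δ ≤ A * (1 / δ) ^ σ * δ := by gcongr
        _ = _ := by field_simp
    have h3 : z ≤ 1 / δ := by
      calc z ≤ ((1 / δ) ^ (σ - 1)) ^ c := by rw [hz]; gcongr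
        _ = 1 / δ := by
          rw [← rpow_mul (by positivity), hc, mul_inv_cancel₀ hσ1.ne', rpow_one]
    rwa [le_div_iff₀ hδ] at h3
  have h := lineIncidences_le_of_scale s u x y m b hδ hδ1 hα hβ hA₁ hA₂ hσ hαβ hε hz0 hzδ hm hx
    hcs hcu
  have hroot : √(Z * A / δ * z ^ (σ - 3)) = Z / z := by
    have : z ^ (σ - 3) = X / z ^ 2 := by
      rw [← hzσ, ← rpow_natCast z 2, ← rpow_sub hz0]; congr 1; push_cast; ring
    rw [this, show Z * A / δ * (X / z ^ 2) = (Z / z) ^ 2 by rw [hX]; field_simp,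
      sqrt_sq (by positivity)]
  rw [hroot] at h
  have hδε : 1 ≤ δ ^ (-ε) := one_le_rpow_of_pos_of_le_one_of_nonpos hδ hδ1 (by linarith)
  have hfin : Z / z = δ ^ (-c) * A ^ c * (s.card : ℝ) ^ (1 - c) * (u.card : ℝ) ^ (1 - c) := by
    rw [mul_assoc, ← mul_rpow hs0.le hu0.le, ← hZ, hz, hX, div_rpow (by positivity) hA0.le,
      mul_rpow hZ0.le hδ.le, rpow_sub hZ0, rpow_one, rpow_neg hδ.le]
    field_simp
  calc _ ≤ 96 * (Z / z) + 96 * blockConst * ((1 + 2 / ε) * δ ^ (-ε)) * (Z / z) := h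
    _ ≤ 96 * (δ ^ (-ε) * (Z / z)) + 96 * blockConst * ((1 + 2 / ε) * δ ^ (-ε)) * (Z / z) := by
        gcongr
        exact le_mul_of_one_le_left (by positivity) hδε
    _ = 96 * (1 + blockConst * (1 + 2 / ε)) * (δ ^ (-ε) * (Z / z)) := by ring
    _ = _ := by
        rw [hfin, sub_eq_add_neg (-c) ε, rpow_add hδ]; ring

end Lines

/-! ### Plane geometry: from tubes and balls to lines and points. -/

theorem inner_plane (x y : Plane) : ⟪x, y⟫ = x 0 * y 0 + x 1 * y 1 := by
  simp [PiLp.inner_apply, Fin.sum_univ_two, mul_comm]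

theorem norm_sq_plane (x : Plane) : ‖x‖ ^ 2 = x 0 ^ 2 + x 1 ^ 2 := by
  rw [EuclideanSpace.real_norm_sq_eq, Fin.sum_univ_two]

theorem abs_coord_sub_le_dist (x y : Plane) (i : Fin 2) : |x i - y i| ≤ dist x y := by
  have h := norm_sq_plane (x - y)
  rw [dist_eq_norm]
  refine abs_le_of_sq_le_sq ?_ (norm_nonneg _)
  rw [h]
  fin_cases i <;> simp <;> positivity

theorem dist_le_of_coord {x y : Plane} {r : ℝ} (h : ∀ i, |x i - y i| ≤ r) :
    dist x y ≤ 2 * r := by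
  have h0 := h 0
  have h1 := h 1
  have hr : 0 ≤ r := (abs_nonneg _).trans h0
  rw [dist_eq_norm]
  refine le_of_sq_le_sq ?_ (by positivity)
  rw [norm_sq_plane]
  have e0 := sq_le_sq' (abs_le.1 h0).1 (abs_le.1 h0).2
  have e1 := sq_le_sq' (abs_le.1 h1).1 (abs_le.1 h1).2
  simp only [PiLp.sub_apply]
  nlinarith

/-- A tube is close to a line which is a graph of slope at most `1` over one of the axes. -/
theorem exists_line_of_isTube {δ : ℝ} {t : Set Plane} (ht : IsTube δ t) :
    ∃ (i : Fin 2) (m b : ℝ), |m| ≤ 1 ∧ ∀ q ∈ t, |q (i + 1) - m * q i - b| ≤ δ := by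
  obtain ⟨c, u, v, hu, hv, huv, rfl⟩ := ht
  have hu2 : u 0 ^ 2 + u 1 ^ 2 = 1 := by rw [← norm_sq_plane, hu]; norm_num
  have hv2 : v 0 ^ 2 + v 1 ^ 2 = 1 := by rw [← norm_sq_plane, hv]; norm_num
  rw [inner_plane] at huv
  have key : ∀ q : Plane, ⟪q - c, u⟫ ^ 2 =
      ((q 1 - c 1) * v 0 - (q 0 - c 0) * v 1) ^ 2 := by
    intro q
    -- In the plane `u` is `v` rotated by a right angle, up to this sign.
    have h1 : (u 1 * v 0 - u 0 * v 1) ^ 2 = 1 := by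
      linear_combination (v 0 ^ 2 + v 1 ^ 2) * hu2 + hv2 - (u 0 * v 0 + u 1 * v 1) * huv
    have e0 : u 0 = -v 1 * (u 1 * v 0 - u 0 * v 1) := by
      linear_combination (-u 0) * hv2 + v 0 * huv
    have e1 : u 1 = v 0 * (u 1 * v 0 - u 0 * v 1) := by
      linear_combination (-u 1) * hv2 + v 1 * huv
    have h2 : ⟪q - c, u⟫ = (u 1 * v 0 - u 0 * v 1) *
        ((q 1 - c 1) * v 0 - (q 0 - c 0) * v 1) := by
      rw [inner_plane]
      simp only [PiLp.sub_apply]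
      linear_combination (q 0 - c 0) * e0 + (q 1 - c 1) * e1
    rw [h2, mul_pow, h1, one_mul]
  have habs : ∀ q ∈ {y : Plane | |⟪y - c, u⟫| ≤ δ / 2 ∧ |⟪y - c, v⟫| ≤ 1 / 2},
      |(q 1 - c 1) * v 0 - (q 0 - c 0) * v 1| ≤ δ / 2 := fun q hq => by
    rw [← (sq_eq_sq_iff_abs_eq_abs _ _).1 (key q)]; exact hq.1
  -- The larger coordinate of the direction is at least `1 / 2`, so dividing by it keeps the slope
  -- at most `1` and at most doubles the error `δ / 2`.
  have main : ∀ a e : ℝ, a ^ 2 + e ^ 2 = 1 → |e| ≤ |a| → |e / a| ≤ 1 ∧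
      ∀ X Y d : ℝ, |Y * a - X * e| ≤ d / 2 → |Y - e / a * X| ≤ d := by
    intro a e hae hle
    have ha : 1 / 2 ≤ |a| := by
      have h1 : e ^ 2 ≤ a ^ 2 := sq_le_sq.2 hle
      rw [← abs_of_pos (by norm_num : (0 : ℝ) < 1 / 2), ← sq_le_sq]
      linarith
    have ha0 : 0 < |a| := by linarith
    have ha' : a ≠ 0 := abs_pos.1 ha0
    refine ⟨by rw [abs_div]; exact (div_le_one ha0).2 hle, fun X Y d hd => ?_⟩
    have : Y - e / a * X = (Y * a - X * e) / a := by field_simp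
    rw [this, abs_div, div_le_iff₀ ha0]
    have : 0 ≤ d := by linarith [abs_nonneg (Y * a - X * e)]
    nlinarith
  rcases le_total |v 1| |v 0| with h | h
  · obtain ⟨hm, hl⟩ := main (v 0) (v 1) hv2 h
    refine ⟨0, v 1 / v 0, c 1 - v 1 / v 0 * c 0, hm, fun q hq => ?_⟩
    have := hl (q 0 - c 0) (q 1 - c 1) δ (habs q hq)
    convert this using 2
    simp only [zero_add]; ring
  · obtain ⟨hm, hl⟩ := main (v 1) (v 0) (by linarith) h
    refine ⟨1, v 0 / v 1, c 0 - v 0 / v 1 * c 1, hm, fun q hq => ?_⟩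
    have := hl (q 1 - c 1) (q 0 - c 0) δ (by rw [abs_sub_comm]; exact habs q hq)
    convert this using 2
    rw [show (1 + 1 : Fin 2) = 0 from rfl]; ring

/-- The part of the unit square near a line is contained in a rectangle of length `2`. -/
theorem exists_rectangle_of_line (i : Fin 2) (m b w : ℝ) (hm : |m| ≤ 1) :
    ∃ R, IsRectangle w 2 R ∧
      ∀ q ∈ unitSquare, |q (i + 1) - m * q i - b| ≤ w / 2 → q ∈ R := by
  set S := √(1 + m ^ 2) with hS
  have hS1 : 1 ≤ S := one_le_sqrt.2 (by nlinarith [sq_nonneg m])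
  have hS0 : 0 < S := by linarith
  have hS2 : S ^ 2 = 1 + m ^ 2 := sq_sqrt (by positivity)
  -- The rectangle is centred at the foot of the perpendicular from the centre of the square to the
  -- line; `d` locates that foot. Seen from there, the square extends at most `1` each way along the
  -- line.
  set d := (1 / 2 - m / 2 - b) / (1 + m ^ 2) with hd
  have hd' : d * (1 + m ^ 2) = 1 / 2 - m / 2 - b := div_mul_cancel₀ _ (by positivity)
  have hunit : (S ^ 2)⁻¹ + (m * S⁻¹) ^ 2 = 1 := by
    field_simp; rw [hS2]
  have hsmall : ∀ z B : ℝ, |z| ≤ B → |z * S⁻¹| ≤ B := by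
    intro z B hz
    rw [abs_mul, abs_of_pos (inv_pos.2 hS0)]
    exact (mul_le_of_le_one_right (abs_nonneg _) (inv_le_one_of_one_le₀ hS1)).trans hz
  have hlong : ∀ X Y : ℝ, X ∈ Set.Icc (0 : ℝ) 1 → Y ∈ Set.Icc (0 : ℝ) 1 →
      |(X - 1 / 2) + m * (Y - 1 / 2)| ≤ 2 / 2 := by
    intro X Y hX hY
    refine (abs_add_le _ _).trans ?_
    rw [abs_mul]
    have h1 : |X - 1 / 2| ≤ 1 / 2 := abs_le.2 ⟨by linarith [hX.1], by linarith [hX.2]⟩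
    have h2 : |Y - 1 / 2| ≤ 1 / 2 := abs_le.2 ⟨by linarith [hY.1], by linarith [hY.2]⟩
    nlinarith [abs_nonneg m, abs_nonneg (Y - 1 / 2)]
  have hnorm : ∀ v : Plane, v 0 ^ 2 + v 1 ^ 2 = 1 → ‖v‖ = 1 := by
    intro v hv
    rw [← norm_sq_plane] at hv
    exact (pow_eq_one_iff_of_nonneg (norm_nonneg v) two_ne_zero).1 hv
  fin_cases i
  · refine ⟨_, ⟨!₂[1 / 2 + m * d, 1 / 2 - d], !₂[-(m * S⁻¹), S⁻¹], !₂[S⁻¹, m * S⁻¹],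
      hnorm _ ?_, hnorm _ ?_, ?_, rfl⟩, fun q hq hql => ⟨?_, ?_⟩⟩
    · simp; linarith
    · simp; linarith
    · rw [inner_plane]; simp; ring
    · have e : ⟪q - !₂[1 / 2 + m * d, 1 / 2 - d], !₂[-(m * S⁻¹), S⁻¹]⟫ =
          (q 1 - m * q 0 - b) * S⁻¹ := by
        rw [inner_plane]; simp
        linear_combination S⁻¹ * hd'
      rw [e]; exact hsmall _ _ (by simpa using hql)
    · have e : ⟪q - !₂[1 / 2 + m * d, 1 / 2 - d], !₂[S⁻¹, m * S⁻¹]⟫ =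
          ((q 0 - 1 / 2) + m * (q 1 - 1 / 2)) * S⁻¹ := by
        rw [inner_plane]; simp; ring
      rw [e]; exact hsmall _ _ (hlong _ _ (hq 0) (hq 1))
  · refine ⟨_, ⟨!₂[1 / 2 - d, 1 / 2 + m * d], !₂[S⁻¹, -(m * S⁻¹)], !₂[m * S⁻¹, S⁻¹],
      hnorm _ ?_, hnorm _ ?_, ?_, rfl⟩, fun q hq hql => ⟨?_, ?_⟩⟩
    · simp; linarith
    · simp; linarith
    · rw [inner_plane]; simp; ring
    · have e : ⟪q - !₂[1 / 2 - d, 1 / 2 + m * d], !₂[S⁻¹, -(m * S⁻¹)]⟫ =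
          (q 0 - m * q 1 - b) * S⁻¹ := by
        rw [inner_plane]; simp
        linear_combination S⁻¹ * hd'
      rw [e]; exact hsmall _ _ (by simpa using hql)
    · have e : ⟪q - !₂[1 / 2 - d, 1 / 2 + m * d], !₂[m * S⁻¹, S⁻¹]⟫ =
          ((q 1 - 1 / 2) + m * (q 0 - 1 / 2)) * S⁻¹ := by
        rw [inner_plane]; simp; ring
      rw [e]; exact hsmall _ _ (hlong _ _ (hq 1) (hq 0))

theorem IsTubeSet.card_le_total {δ α K : ℝ} {T : Finset (Set Plane)} (hT : IsTubeSet δ α K T)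
    (hδ1 : δ ≤ 1) : (T.card : ℝ) ≤ K * (1 / δ) ^ α := by
  classical
  obtain ⟨R, hR, hsub⟩ := exists_rectangle_of_line 0 0 (1 / 2) 1 (by simp)
  refine le_trans ?_ (hT.card_le 1 ⟨hδ1, le_rfl⟩ R hR)
  rw [Finset.filter_true_of_mem]
  intro t ht q hq
  have hq' := hT.subset_unitSquare t ht hq
  refine hsub q hq' ?_
  have h1 := hq' 1
  rw [zero_add, zero_mul, sub_zero]
  exact abs_le.2 ⟨by linarith [h1.1], by linarith [h1.2]⟩

theorem IsBallSet.card_le_total {δ β K : ℝ} {P : Finset (Set Plane)} (hP : IsBallSet δ β K P)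
    (hδ1 : δ ≤ 1) : (P.card : ℝ) ≤ K * (1 / δ) ^ β := by
  classical
  refine le_trans ?_ (hP.card_le 1 ⟨hδ1, le_rfl⟩ _ ⟨!₂[1 / 2, 1 / 2], rfl⟩)
  rw [Finset.filter_true_of_mem]
  intro p hp q hq
  have hq' := hP.subset_unitSquare p hp hq
  rw [Metric.mem_closedBall]
  refine (dist_le_of_coord (r := 1 / 2) fun i => ?_).trans (by norm_num)
  have h := hq' i
  have e : (!₂[(1 : ℝ) / 2, 1 / 2] : Plane) i = 1 / 2 := by fin_cases i <;> simp
  rw [e]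
  exact abs_le.2 ⟨by linarith [h.1], by linarith [h.2]⟩

/-- The growth bound at scale `k * r`, from the bound for scales up to `1`. -/
theorem rpow_scale_le {K k r δ γ : ℝ} (hK : 0 ≤ K) (hk : 1 ≤ k) (hr : 0 ≤ r) (hδ : 0 < δ)
    (hγ : γ ≤ 2) : K * (k * r / δ) ^ γ ≤ k ^ 2 * K * (r / δ) ^ γ := by
  rw [mul_div_assoc, mul_rpow (by linarith) (by positivity)]
  have : k ^ γ ≤ k ^ 2 := by
    rw [← rpow_natCast k 2]
    exact rpow_le_rpow_of_exponent_le hk (by exact_mod_cast hγ)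
  calc K * (k ^ γ * (r / δ) ^ γ) ≤ K * (k ^ 2 * (r / δ) ^ γ) := by gcongr
    _ = _ := by ring

/-- In the unit square, a tube whose line has parameters `r`-close to those of `t` stays within `δ +
r + r ≤ 3 r` of the line of `t`, hence in a rectangle of width `6 r`; `36 = 6²` comes from `α ≤ 2`.
Once `6 r ≥ 1` the total count suffices. -/
theorem IsTubeSet.card_near_line_le {δ α K : ℝ} {T : Finset (Set Plane)}
    (hT : IsTubeSet δ α K T) (hδ : 0 < δ) (hδ1 : δ ≤ 1) (hK : 0 ≤ K) (hα0 : 0 ≤ α) (hα : α ≤ 2)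
    {i : Fin 2} {U : Finset (Set Plane)} (hU : U ⊆ T) {m b : Set Plane → ℝ}
    (hline : ∀ t ∈ U, |m t| ≤ 1 ∧ ∀ q ∈ t, |q (i + 1) - m t * q i - b t| ≤ δ)
    {r : ℝ} (hr : δ ≤ r) {t : Set Plane} (ht : t ∈ U) :
    ((U.filter fun t' => max |m t - m t'| |b t - b t'| ≤ r).card : ℝ) ≤
      36 * K * (r / δ) ^ α := by
  classical
  have hr0 : 0 < r := hδ.trans_le hr
  have hfin : K * (6 * r / δ) ^ α ≤ 36 * K * (r / δ) ^ α := by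
    refine (rpow_scale_le hK (by norm_num) hr0.le hδ hα).trans_eq ?_
    norm_num
  refine le_trans ?_ hfin
  rcases le_total (6 * r) 1 with h6 | h6
  · obtain ⟨R, hR, hsub⟩ := exists_rectangle_of_line i (m t) (b t) (6 * r) (hline t ht).1
    refine le_trans ?_ (hT.card_le (6 * r) ⟨by linarith, h6⟩ R hR)
    refine Nat.cast_le.2 (Finset.card_le_card fun t' ht' => ?_)
    rw [Finset.mem_filter] at ht'
    refine Finset.mem_filter.2 ⟨hU ht'.1, fun q hq => ?_⟩
    have hq' := hT.subset_unitSquare t' (hU ht'.1) hq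
    refine hsub q hq' ?_
    have h1 := (hline t' ht'.1).2 q hq
    have h2 := (le_max_left _ _).trans ht'.2
    have h3 := (le_max_right _ _).trans ht'.2
    have hqi : |q i| ≤ 1 := abs_le.2 ⟨by linarith [(hq' i).1], (hq' i).2⟩
    have e : q (i + 1) - m t * q i - b t =
        (q (i + 1) - m t' * q i - b t') - (m t - m t') * q i - (b t - b t') := by ring
    rw [e]
    refine (abs_sub _ _).trans ?_
    have h4 := abs_sub (q (i + 1) - m t' * q i - b t') ((m t - m t') * q i)
    rw [abs_mul] at h4
    have h5 : |m t - m t'| * |q i| ≤ r :=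
      (mul_le_of_le_one_right (abs_nonneg _) hqi).trans h2
    linarith
  · calc _ ≤ (T.card : ℝ) :=
          Nat.cast_le.2 (Finset.card_le_card ((Finset.filter_subset _ _).trans hU))
      _ ≤ K * (1 / δ) ^ α := hT.card_le_total hδ1
      _ ≤ _ := by gcongr

/-- The centres are at distance at most `2 r`, so the balls lie in one of radius `2 r + δ ≤ 3 r`,
whence `9 = 3²`. -/
theorem IsBallSet.card_near_le {δ β K : ℝ} {P : Finset (Set Plane)}
    (hP : IsBallSet δ β K P) (hδ : 0 < δ) (hδ1 : δ ≤ 1) (hK : 0 ≤ K) (hβ0 : 0 ≤ β) (hβ : β ≤ 2)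
    {c : Set Plane → Plane} (hc : ∀ p ∈ P, p = Metric.closedBall (c p) δ) (i : Fin 2)
    {r : ℝ} (hr : δ ≤ r) (p : Set Plane) :
    ((P.filter fun p' => max |c p i - c p' i| |c p (i + 1) - c p' (i + 1)| ≤ r).card : ℝ) ≤
      9 * K * (r / δ) ^ β := by
  classical
  have hr0 : 0 < r := hδ.trans_le hr
  have hfin : K * (3 * r / δ) ^ β ≤ 9 * K * (r / δ) ^ β := by
    refine (rpow_scale_le hK (by norm_num) hr0.le hδ hβ).trans_eq ?_
    norm_num
  refine le_trans ?_ hfin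
  rcases le_total (3 * r) 1 with h3 | h3
  · refine le_trans ?_ (hP.card_le (3 * r) ⟨by linarith, h3⟩ _ ⟨c p, rfl⟩)
    refine Nat.cast_le.2 (Finset.card_le_card fun p' hp' => ?_)
    rw [Finset.mem_filter] at hp'
    refine Finset.mem_filter.2 ⟨hp'.1, ?_⟩
    rw [hc p' hp'.1]
    refine Metric.closedBall_subset_closedBall' ?_
    have h1 := (le_max_left _ _).trans hp'.2
    have h2 := (le_max_right _ _).trans hp'.2
    have := dist_le_of_coord (x := c p) (y := c p') (r := r) fun j => by
      fin_cases i <;> fin_cases j <;> first | exact h1 | exact h2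
    rw [dist_comm]; linarith
  · calc _ ≤ (P.card : ℝ) := Nat.cast_le.2 (Finset.card_le_card (Finset.filter_subset _ _))
      _ ≤ K * (1 / δ) ^ β := hP.card_le_total hδ1
      _ ≤ _ := by gcongr

end TubeIncidence

/-! ### Assembly of the theorem. -/

theorem theorem1p2 (ε : ℝ) (hε : 0 < ε) :
    ∃ C : ℝ, 0 < C ∧
      ∀ α β Kα Kβ δ c : ℝ,
        0 ≤ α → α ≤ 2 → 0 ≤ β → β ≤ 2 → 1 ≤ Kα → 1 ≤ Kβ → 0 < δ → δ ≤ 1 →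
        c⁻¹ = max (α + β - 1) 2 →
        ∀ P T : Finset (Set TubeIncidence.Plane),
          TubeIncidence.IsBallSet δ β Kβ P → TubeIncidence.IsTubeSet δ α Kα T →
          (TubeIncidence.incidences P T : ℝ) ≤
            C * δ ^ (-c - ε) * (Kα * Kβ) ^ c * (P.card : ℝ) ^ (1 - c) * (T.card : ℝ) ^ (1 - c) := by
  classical
  open TubeIncidence in
  have hB := blockConst_pos
  -- The `2` counts the two axes over which the lines are graphs; `324 = 9 * 36` comes from the
  -- counting constants and `c ≤ 1`.
  refine ⟨2 * (324 * (96 * (1 + blockConst * (1 + 2 / ε)))), by positivity, ?_⟩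
  intro α β Kα Kβ δ c hα0 hα hβ0 hβ hKα hKβ hδ hδ1 hc P T hP hT
  set σ := max (α + β) 3 with hσ
  have hσ1 : c = (σ - 1)⁻¹ := by
    rw [← inv_inv c, hc, hσ]
    congr 1
    rcases le_total (α + β) 3 with h | h
    · rw [max_eq_right h, max_eq_right (by linarith)]; norm_num
    · rw [max_eq_left h, max_eq_left (by linarith)]
  have hσ3 : 3 ≤ σ := le_max_right _ _
  have hc0 : 0 ≤ c := by rw [hσ1]; exact inv_nonneg.2 (by linarith)
  have hc1 : c ≤ 1 := by rw [hσ1]; exact inv_le_one_of_one_le₀ (by linarith)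
  have hcen : ∀ p ∈ P, ∃ x : Plane, p = Metric.closedBall x δ := hP.isBall
  choose! z hz using hcen
  have hlines : ∀ t ∈ T, ∃ (i : Fin 2) (m b : ℝ), |m| ≤ 1 ∧
      ∀ q ∈ t, |q (i + 1) - m * q i - b| ≤ δ := fun t ht => exists_line_of_isTube (hT.isTube t ht)
  choose! i m b hline using hlines
  have hz1 : ∀ p ∈ P, ∀ j, |z p j| ≤ 1 := by
    intro p hp j
    have : z p ∈ p := by
      have h := Metric.mem_closedBall_self (x := z p) hδ.le
      rwa [← hz p hp] at h
    have := hP.subset_unitSquare p hp this j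
    exact abs_le.2 ⟨by linarith [this.1], this.2⟩
  have hcount : incidences P T ≤ ∑ j : Fin 2, lineIncidences P (T.filter fun t => i t = j)
      (fun p => z p j) (fun p => z p (j + 1)) m b δ := by
    rw [incidences, Finset.card_filter, Finset.sum_product_right,
      ← Finset.sum_fiberwise T i]
    refine Finset.sum_le_sum fun j _ => Finset.sum_le_sum fun t ht => ?_
    obtain ⟨htT, rfl⟩ := Finset.mem_filter.1 ht
    rw [← Finset.card_filter]
    refine Finset.card_le_card fun p hp => ?_
    obtain ⟨hpP, q, hqp, hqt⟩ := Finset.mem_filter.1 hp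
    refine Finset.mem_filter.2 ⟨hpP, ?_⟩
    have h1 := (hline t htT).2 q hqt
    have h2 := (hline t htT).1
    have hd : dist q (z p) ≤ δ := by
      rw [← Metric.mem_closedBall, ← hz p hpP]; exact hqp
    have h3 := (abs_coord_sub_le_dist q (z p) (i t)).trans hd
    have h4 := (abs_coord_sub_le_dist q (z p) (i t + 1)).trans hd
    have h5 : |m t * (q (i t) - z p (i t))| ≤ δ := by
      rw [abs_mul]; exact (mul_le_of_le_one_left (abs_nonneg _) h2).trans h3
    rw [abs_le] at h1 h4 h5 ⊢
    -- One `δ` each from the tube's thickness and from the two coordinates of the displacement to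
    -- the centre of the ball.
    constructor <;> linarith [h1.1, h1.2, h4.1, h4.2, h5.1, h5.2]
  set B := 324 * (96 * (1 + blockConst * (1 + 2 / ε))) * δ ^ (-c - ε) * (Kα * Kβ) ^ c *
    (P.card : ℝ) ^ (1 - c) * (T.card : ℝ) ^ (1 - c) with hBdef
  have hpiece : ∀ j : Fin 2, (lineIncidences P (T.filter fun t => i t = j)
      (fun p => z p j) (fun p => z p (j + 1)) m b δ : ℝ) ≤ B := by
    intro j
    have hlj : ∀ t ∈ T.filter fun t => i t = j, |m t| ≤ 1 ∧
        ∀ q ∈ t, |q (j + 1) - m t * q j - b t| ≤ δ := by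
      intro t ht
      obtain ⟨htT, rfl⟩ := Finset.mem_filter.1 ht
      exact hline t htT
    have hTj : (((T.filter fun t => i t = j).card : ℕ) : ℝ) ≤ T.card :=
      Nat.cast_le.2 (Finset.card_le_card (Finset.filter_subset _ _))
    have hpβ : 0 ≤ (1 / δ) ^ β := by positivity
    have hpα : 0 ≤ (1 / δ) ^ α := by positivity
    have h := lineIncidences_le P (T.filter fun t => i t = j) (fun p => z p j)
      (fun p => z p (j + 1)) m b (A₁ := 9 * Kβ) (A₂ := 36 * Kα) (σ := σ) hδ hδ1 hα hβ
      (by positivity) (by positivity) hσ3 (le_max_left _ _) hε (fun t ht => (hlj t ht).1)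
      (fun p hp => hz1 p hp j)
      (fun r hr p _ => hP.card_near_le hδ hδ1 (by linarith) hβ0 hβ hz j hr p)
      (fun r hr t ht => hT.card_near_line_le hδ hδ1 (by linarith) hα0 hα
        (Finset.filter_subset _ _) hlj hr ht)
      ((hP.card_le_total hδ1).trans (by nlinarith))
      (hTj.trans ((hT.card_le_total hδ1).trans (by nlinarith)))
    rw [← hσ1] at h
    refine h.trans ?_
    have hK : (9 * Kβ * (36 * Kα)) ^ c ≤ 324 * (Kα * Kβ) ^ c := by
      rw [show 9 * Kβ * (36 * Kα) = 324 * (Kα * Kβ) by ring,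
        mul_rpow (by norm_num) (by positivity)]
      gcongr
      calc (324 : ℝ) ^ c ≤ 324 ^ (1 : ℝ) := rpow_le_rpow_of_exponent_le (by norm_num) hc1
        _ = 324 := rpow_one _
    have hT' : (((T.filter fun t => i t = j).card : ℕ) : ℝ) ^ (1 - c) ≤ (T.card : ℝ) ^ (1 - c) :=
      rpow_le_rpow (by positivity) hTj (by linarith)
    calc _ ≤ 96 * (1 + blockConst * (1 + 2 / ε)) * δ ^ (-c - ε) * (324 * (Kα * Kβ) ^ c) *
          (P.card : ℝ) ^ (1 - c) * (T.card : ℝ) ^ (1 - c) := by gcongr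
      _ = B := by rw [hBdef]; ring
  calc (incidences P T : ℝ) ≤ ∑ j : Fin 2, (lineIncidences P (T.filter fun t => i t = j)
      (fun p => z p j) (fun p => z p (j + 1)) m b δ : ℝ) := by exact_mod_cast hcount
    _ ≤ ∑ j : Fin 2, B := Finset.sum_le_sum fun j _ => hpiece j
    _ = _ := by rw [Fin.sum_univ_two, hBdef]; ring
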